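/- Let $A$ be an expansive integral $d\times d$ matrix (all entries are integers and all complex eigenvalues have modulus $>1$; in particular $A$ is invertible), let $A^*$ be its transpose, and let $\Psi=\{\psi_1,\dots,\psi_r\}$, $\Phi=\{\phi_1,\dots,\phi_r\}\subset L^2(\mathbb R^d)$. For $f \in L^2(\mathbb R^d)$ put $T_\alpha f=f(\cdot-\alpha)$, $D_Af=\sqrt{|\det A|}\,f(A\,\cdot)$, $\widetilde D_Af=|\det A|\,f(A\,\cdot)$, and let $\hat f$ be the Fourier transform, $\hat f(\xi)=\int f(x)e^{-2\pi i x\cdot\xi}\,dx$ for $f\in L^1\cap L^2$. The affine system is $\mathcal U_A(\Psi)=\{D_A^nT_z\psi_i : n\in\mathbb Z,\ z\in\mathbb Z^d,\ 1\le i\le r\}$; the quasi-affine system $\mathcal U^q_A(\Psi)$ consists of $D_A^nT_z\psi_i$ for $n\ge 0$ and $T_z\widetilde D_A^n\psi_i$ for $n<0$. Both are regarded as sequences indexed by $(n,z,i)\in \mathbb Z\times\mathbb Z^d\times\{1,\dots,r\}$. A sequence $(x_j)$ in a Hilbert space $H$ is Bessel if there is a constant $C$ with $\sum_j|\langle v,x_j\rangle|^2\le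 C\|v\|^2$ for all $v \in H$; two Bessel sequences $(x_j)$, $(y_j)$ with the same index set are orthogonal if their mixed dual Gramian $v\mapsto\sum_j\langle v,x_j\rangle y_j$ is the zero operator. Suppose that $\mathcal U_A(\Psi)$ and $\mathcal U_A(\Phi)$ are Bessel sequences. Then they are orthogonal if and only if for all $q\in\mathbb Z^d\setminus A^*\mathbb Z^d$, $$\sum_{i=1}^r\sum_{j\ge0}\overline{\hat\psi_i(A^{*j}\xi)}\,\hat\phi_i(A^{*j}(\xi+q))=0\quad\text{for a.e. }\xi,$$ and $$\sum_{i=1}^r\sum_{j\in\mathbb Z}\overline{\hat\psi_i(A^{*j}\xi)}\,\hat\phi_i(A^{*j}\xi)=0\quad\text{for a.e. }\xi$$ (the series being absolutely convergent for a.e. $\xi$). Moreover, the quasi-affine systems $\mathcal U^q_A(\Psi)$ and $\mathcal U^q_A(\Phi)$ are Bessel sequences as well, and they are orthogonal if and only if the same two conditions hold. -/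

import Mathlib

open MeasureTheory FourierTransform
open scoped ENNReal ComplexConjugate

noncomputable section

namespace OrthFrames

/-! ### Bessel sequences and orthogonality in a Hilbert space -/

section Bessel

variable {H : Type*} [NormedAddCommGroup H] [InnerProductSpace ℂ H] {J : Type*}

/-- `X` is a Bessel sequence: the coefficients `⟨v, x_j⟩` satisfy
`∑ j, |⟨v, x_j⟩|² ≤ C ‖v‖²` for some constant `C` and all `v`. The inner product of Mathlib is
linear in the second variable, so `inner ℂ (X j) v` is `⟨v, x_j⟩` in the convention of analysis. -/
def IsBessel (X : J → H) : Prop :=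
  ∃ C : ℝ, 0 < C ∧ ∀ v : H,
    Summable (fun j => ‖inner ℂ (X j) v‖ ^ 2) ∧
      ∑' j, ‖inner ℂ (X j) v‖ ^ 2 ≤ C * ‖v‖ ^ 2

/-- Two Bessel sequences over the same index set are orthogonal if their mixed dual Gramian
`v ↦ ∑ j, ⟨v, x_j⟩ y_j` is the zero operator. -/
def IsOrthogonal (X Y : J → H) : Prop :=
  IsBessel X ∧ IsBessel Y ∧ ∀ v : H, HasSum (fun j => inner ℂ (X j) v • Y j) 0

end Bessel

/-! ### Operators on `L²(ℝᵈ)` -/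

/-- The Hilbert space `L²(ℝᵈ)` of complex valued functions. -/
abbrev L2 (d : ℕ) : Type := Lp (α := EuclideanSpace ℝ (Fin d)) ℂ 2 volume

variable {d : ℕ}

/-- The matrix-vector product `M x` for `x` in Euclidean space. -/
def matVec (M : Matrix (Fin d) (Fin d) ℝ) (x : EuclideanSpace ℝ (Fin d)) :
    EuclideanSpace ℝ (Fin d) :=
  WithLp.toLp 2 (M.mulVec x.ofLp)

/-- A point of `ℤᵈ`, seen in `ℝᵈ`. -/
def intVec (z : Fin d → ℤ) : EuclideanSpace ℝ (Fin d) :=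
  WithLp.toLp 2 (fun i => (z i : ℝ))

/-- The translation operator `(T_α f)(x) = f(x - α)`. -/
def translation (α : EuclideanSpace ℝ (Fin d)) : L2 d →+ L2 d :=
  Lp.compMeasurePreserving (fun x => x - α) (measurePreserving_sub_right volume α)

theorem matVec_mul (M N : Matrix (Fin d) (Fin d) ℝ) (x : EuclideanSpace ℝ (Fin d)) :
    matVec (M * N) x = matVec M (matVec N x) := by
  simp [matVec, Matrix.mulVec_mulVec]

theorem matVec_one (x : EuclideanSpace ℝ (Fin d)) :
    matVec (1 : Matrix (Fin d) (Fin d) ℝ) x = x := by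
  simp [matVec]

theorem matVec_eq (M : Matrix (Fin d) (Fin d) ℝ) :
    matVec M = ⇑(Matrix.toEuclideanLin M) := by
  funext x
  simp [matVec, Matrix.toLpLin_apply]

theorem measurable_matVec (M : Matrix (Fin d) (Fin d) ℝ) : Measurable (matVec M) := by
  rw [matVec_eq]
  exact (LinearMap.continuous_of_finiteDimensional _).measurable

theorem map_matVec (A : GL (Fin d) ℝ) :
    Measure.map (matVec (A : Matrix (Fin d) (Fin d) ℝ)) volume =
      ENNReal.ofReal |(A : Matrix (Fin d) (Fin d) ℝ).det⁻¹| •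
        (volume : Measure (EuclideanSpace ℝ (Fin d))) := by
  have hdet : LinearMap.det (Matrix.toEuclideanLin (A : Matrix (Fin d) (Fin d) ℝ))
      = (A : Matrix (Fin d) (Fin d) ℝ).det := by
    rw [Matrix.toEuclideanLin, Matrix.toLpLin_eq_toLin, LinearMap.det_toLin]
  have h0 : (A : Matrix (Fin d) (Fin d) ℝ).det ≠ 0 := by
    have := A.isUnit.map (Matrix.detMonoidHom (n := Fin d) (R := ℝ))
    exact this.ne_zero
  rw [matVec_eq, Measure.map_linearMap_addHaar_eq_smul_addHaar _ (by rwa [hdet]), hdet]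

theorem quasiMeasurePreserving_matVec (A : GL (Fin d) ℝ) :
    Measure.QuasiMeasurePreserving (matVec (A : Matrix (Fin d) (Fin d) ℝ)) volume volume := by
  refine ⟨measurable_matVec _, ?_⟩
  rw [map_matVec]
  exact Measure.smul_absolutelyContinuous

theorem eLpNorm_comp_matVec (A : GL (Fin d) ℝ) (f : L2 d) :
    eLpNorm (fun x => f (matVec (A : Matrix (Fin d) (Fin d) ℝ) x)) 2 volume =
      ENNReal.ofReal |(A : Matrix (Fin d) (Fin d) ℝ).det⁻¹| ^ (1 / (2 : ℝ)) *
        eLpNorm f 2 volume := by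
  have h := eLpNorm_map_measure (p := 2) (f := matVec (A : Matrix (Fin d) (Fin d) ℝ))
    (g := f) (μ := volume)
    (by rw [map_matVec]; exact (Lp.aestronglyMeasurable f).mono_ac
          Measure.smul_absolutelyContinuous)
    (measurable_matVec _).aemeasurable
  rw [map_matVec, eLpNorm_smul_measure_of_ne_top (by simp)] at h
  simpa [Function.comp_def] using h.symm

theorem memLp_comp_matVec (A : GL (Fin d) ℝ) (f : L2 d) :
    MemLp (fun x => f (matVec (A : Matrix (Fin d) (Fin d) ℝ) x)) 2 volume := by
  refine ⟨(Lp.aestronglyMeasurable f).comp_quasiMeasurePreserving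
    (quasiMeasurePreserving_matVec A), ?_⟩
  rw [eLpNorm_comp_matVec]
  exact ENNReal.mul_lt_top (ENNReal.rpow_lt_top_of_nonneg (by norm_num) ENNReal.ofReal_ne_top)
    (Lp.eLpNorm_lt_top f)

/-- The substitution `f ↦ f(A ·)` as a continuous linear map of `L²(ℝᵈ)`. -/
def substCLM (A : GL (Fin d) ℝ) : L2 d →L[ℂ] L2 d :=
  LinearMap.mkContinuous
    { toFun := fun f => (memLp_comp_matVec A f).toLp _
      map_add' := fun f g => by
        apply Lp.ext
        filter_upwards [(memLp_comp_matVec A (f + g)).coeFn_toLp,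
          (memLp_comp_matVec A f).coeFn_toLp, (memLp_comp_matVec A g).coeFn_toLp,
          Lp.coeFn_add ((memLp_comp_matVec A f).toLp _) ((memLp_comp_matVec A g).toLp _),
          (quasiMeasurePreserving_matVec A).ae (Lp.coeFn_add f g)] with x h1 h2 h3 h4 h5
        rw [h1, h4, Pi.add_apply, h2, h3, h5, Pi.add_apply]
      map_smul' := fun c f => by
        apply Lp.ext
        filter_upwards [(memLp_comp_matVec A (c • f)).coeFn_toLp,
          (memLp_comp_matVec A f).coeFn_toLp,
          Lp.coeFn_smul c ((memLp_comp_matVec A f).toLp _),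
          (quasiMeasurePreserving_matVec A).ae (Lp.coeFn_smul c f)] with x h1 h2 h4 h5
        rw [h1, RingHom.id_apply, h4, Pi.smul_apply, h2, h5, Pi.smul_apply] }
    (ENNReal.ofReal |(A : Matrix (Fin d) (Fin d) ℝ).det⁻¹| ^ (1 / (2 : ℝ))).toReal
    (fun f => by
      simp only [LinearMap.coe_mk, AddHom.coe_mk, Lp.norm_toLp, eLpNorm_comp_matVec,
        ENNReal.toReal_mul]
      rfl)

theorem substCLM_coeFn (A : GL (Fin d) ℝ) (f : L2 d) :
    substCLM A f =ᵐ[volume] fun x => f (matVec (A : Matrix (Fin d) (Fin d) ℝ) x) :=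
  (memLp_comp_matVec A f).coeFn_toLp

theorem substCLM_comp (A B : GL (Fin d) ℝ) (f : L2 d) :
    substCLM A (substCLM B f) = substCLM (B * A) f := by
  apply Lp.ext
  filter_upwards [substCLM_coeFn A (substCLM B f), substCLM_coeFn (B * A) f,
    (quasiMeasurePreserving_matVec A).ae (substCLM_coeFn B f)] with x h1 h2 h3
  rw [h1, h2, h3, Units.val_mul, matVec_mul]

theorem substCLM_one (f : L2 d) : substCLM 1 f = f := by
  apply Lp.ext
  filter_upwards [substCLM_coeFn 1 f] with x h1
  rw [h1, Units.val_one, matVec_one]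

/-- The substitution `f ↦ f(A ·)` as an invertible operator of `L²(ℝᵈ)`. -/
def subst (A : GL (Fin d) ℝ) : L2 d ≃L[ℂ] L2 d :=
  ContinuousLinearEquiv.equivOfInverse (substCLM A) (substCLM A⁻¹)
    (fun f => by rw [substCLM_comp, mul_inv_cancel, substCLM_one])
    (fun f => by rw [substCLM_comp, inv_mul_cancel, substCLM_one])

/-- Multiplication by a nonzero complex scalar as an invertible operator of `L²(ℝᵈ)`. -/
def scalar (c : ℂˣ) : L2 d ≃L[ℂ] L2 d :=
  ContinuousLinearEquiv.smulLeft c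

theorem abs_det_ne_zero (A : GL (Fin d) ℝ) : |(A : Matrix (Fin d) (Fin d) ℝ).det| ≠ 0 :=
  abs_ne_zero.mpr (A.isUnit.map (Matrix.detMonoidHom (n := Fin d) (R := ℝ))).ne_zero

theorem sqrt_abs_det_ne_zero (A : GL (Fin d) ℝ) :
    Real.sqrt |(A : Matrix (Fin d) (Fin d) ℝ).det| ≠ 0 := by
  have := abs_det_ne_zero A
  positivity

/-- The dilation operator `(D_A f)(x) = √|det A| f(A x)`. Integer powers `D_A ^ n` are taken in
the group of invertible operators. -/
def dilation (A : GL (Fin d) ℝ) : L2 d ≃L[ℂ] L2 d :=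
  scalar (Units.mk0 ((Real.sqrt |(A : Matrix (Fin d) (Fin d) ℝ).det| : ℝ) : ℂ)
    (by exact_mod_cast sqrt_abs_det_ne_zero A)) * subst A

/-- The renormalized dilation operator `f ↦ |det A| f(A ·)`. -/
def renormDilation (A : GL (Fin d) ℝ) : L2 d ≃L[ℂ] L2 d :=
  scalar (Units.mk0 ((|(A : Matrix (Fin d) (Fin d) ℝ).det| : ℝ) : ℂ)
    (by exact_mod_cast abs_det_ne_zero A)) * subst A

/-! ### Expansive integral matrices, affine and quasi-affine systems -/

/-- All complex eigenvalues have modulus strictly greater than `1`. -/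
def IsExpansive (M : Matrix (Fin d) (Fin d) ℝ) : Prop :=
  ∀ μ : ℂ, Module.End.HasEigenvalue (Matrix.toLin' (M.map (fun t : ℝ => (t : ℂ)))) μ → 1 < ‖μ‖

/-- All entries are integers. -/
def IsIntegerValued (M : Matrix (Fin d) (Fin d) ℝ) : Prop :=
  ∀ i j, ∃ m : ℤ, M i j = (m : ℝ)

variable {r : ℕ}

/-- The affine system `D_A ^ n T_z ψ_i`, indexed by `n ∈ ℤ`, `z ∈ ℤᵈ` and `i`. -/
def affineSystem (A : GL (Fin d) ℝ) (Ψ : Fin r → L2 d) :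
    ℤ × (Fin d → ℤ) × Fin r → L2 d :=
  fun p => (dilation A ^ p.1) (translation (intVec p.2.1) (Ψ p.2.2))

/-- The quasi-affine system: `D_A ^ n T_z ψ_i` for `n ≥ 0`, and `T_z D̃_A ^ n ψ_i` for `n < 0`,
where `D̃_A` is the renormalized dilation. -/
def quasiAffineSystem (A : GL (Fin d) ℝ) (Ψ : Fin r → L2 d) :
    ℤ × (Fin d → ℤ) × Fin r → L2 d :=
  fun p =>
    if 0 ≤ p.1 then (dilation A ^ p.1) (translation (intVec p.2.1) (Ψ p.2.2))
    else translation (intVec p.2.1) ((renormDilation A ^ p.1) (Ψ p.2.2))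

/-- The two families of equations, with `A* = Aᵀ`. The vanishing of a double series is `HasSum`
over the pairs `(j, i)`, so absolute convergence is part of it. -/
def OrthogonalityEquations (A : GL (Fin d) ℝ) (Ψ Φ : Fin r → L2 d) : Prop :=
  (∀ q : Fin d → ℤ,
    (¬ ∃ z : Fin d → ℤ, intVec q = matVec (A : Matrix (Fin d) (Fin d) ℝ).transpose (intVec z)) →
    ∀ᵐ ξ : EuclideanSpace ℝ (Fin d),
      HasSum (fun p : ℕ × Fin r =>
        conj ((𝓕 (Ψ p.2) : L2 d)
          (matVec ((A : Matrix (Fin d) (Fin d) ℝ).transpose ^ p.1) ξ)) *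
        (𝓕 (Φ p.2) : L2 d)
          (matVec ((A : Matrix (Fin d) (Fin d) ℝ).transpose ^ p.1) (ξ + intVec q))) 0) ∧
  (∀ᵐ ξ : EuclideanSpace ℝ (Fin d),
      HasSum (fun p : ℤ × Fin r =>
        conj ((𝓕 (Ψ p.2) : L2 d)
          (matVec ((A : Matrix (Fin d) (Fin d) ℝ).transpose ^ p.1) ξ)) *
        (𝓕 (Φ p.2) : L2 d)
          (matVec ((A : Matrix (Fin d) (Fin d) ℝ).transpose ^ p.1) ξ)) 0)

end OrthFrames

end

/-!
By Plancherel and periodization, the mixed dual Gramian of two shift-invariant layers is on the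
Fourier side a sum over the frequencies `p` of a lattice, each contributing the pairing of a test
function with its translate by `p` against a correlation function of the generators. Expansiveness
bounds the terms with `p ≠ 0`, and then the Bessel property the terms with `p = 0`, so that the sums
over the layers converge absolutely. Modulating the test function by `y` turns the Gramian into an
absolutely convergent series `∑ c p * exp (2πi⟪y, p⟫)`. A series of this kind vanishes for all `y`
if and only if every coefficient `c p` vanishes, so orthogonality is the almost everywhere vanishing
of the correlation functions, one equation for every frequency. The frequencies `p ≠ 0` fall into
orbits of `A*`, each containing exactly one integer vector outside `A*ℤᵈ`.

Passing from the affine to the quasi-affine system keeps exactly the terms with integer `p`. They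
are isolated by averaging over the modulations by integer vectors, which preserves the Bessel bound;
and they suffice for the equations, since every orbit of frequencies meets `ℤᵈ`.
-/

namespace OrthFrames

open Bornology Filter Function Topology

section Preliminaries

theorem fourierChar_eq_one_iff {t : ℝ} : 𝐞 t = 1 ↔ ∃ m : ℤ, (m : ℝ) = t := by
  rw [Real.fourierChar_apply', Circle.exp_eq_one]
  refine exists_congr fun m => ⟨fun h => ?_, fun h => by rw [← h]; ring⟩
  nlinarith [Real.pi_pos]

variable {d : ℕ}

@[simp]
theorem intVec_apply (z : Fin d → ℤ) (i : Fin d) : intVec z i = z i := rfl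

@[simp]
theorem intVec_zero : intVec (0 : Fin d → ℤ) = 0 := by ext i; simp

theorem intVec_add (z w : Fin d → ℤ) : intVec (z + w) = intVec z + intVec w := by ext i; simp

theorem intVec_neg (z : Fin d → ℤ) : intVec (-z) = -intVec z := by ext i; simp

theorem intVec_injective : Injective (intVec (d := d)) := fun z w h => by
  funext i
  simpa using congrArg (· i) h

theorem one_le_norm_intVec {z : Fin d → ℤ} (hz : z ≠ 0) : 1 ≤ ‖intVec z‖ := by
  obtain ⟨i, hi⟩ := Function.ne_iff.mp hz
  calc (1 : ℝ) ≤ |(z i : ℝ)| := by exact_mod_cast Int.one_le_abs hi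
    _ ≤ ‖intVec z‖ := PiLp.norm_apply_le (intVec z) i

theorem fourierChar_inner (x y : EuclideanSpace ℝ (Fin d)) :
    (𝐞 (inner ℝ x y) : ℂ) = ∏ i, (𝐞 (x i * y i) : ℂ) := by
  simp only [PiLp.inner_apply, RCLike.inner_apply, conj_trivial, mul_comm]
  exact map_prod (Circle.coeHom.comp Real.fourierChar.toMonoidHom) (fun i => .ofAdd (x i * y i)) _

theorem fourierChar_inner_intVec_intVec (z w : Fin d → ℤ) :
    𝐞 (inner ℝ (intVec z) (intVec w)) = 1 := by
  rw [← Circle.coe_eq_one, fourierChar_inner]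
  exact Finset.prod_eq_one fun i _ =>
    Circle.coe_eq_one.mpr (fourierChar_eq_one_iff.mpr ⟨z i * w i, by simp⟩)

theorem continuous_fourierChar_inner (y : EuclideanSpace ℝ (Fin d)) :
    Continuous fun x : EuclideanSpace ℝ (Fin d) => (𝐞 (inner ℝ y x) : ℂ) :=
  continuous_subtype_val.comp (Real.continuous_fourierChar.comp (by fun_prop))

theorem integrable_mul_fourierChar_inner {μ : Measure (EuclideanSpace ℝ (Fin d))}
    {w : EuclideanSpace ℝ (Fin d) → ℂ} (hw : Integrable w μ) (y : EuclideanSpace ℝ (Fin d)) :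
    Integrable (fun x => w x * 𝐞 (inner ℝ y x)) μ :=
  hw.mul_bdd (c := 1) (continuous_fourierChar_inner y).aestronglyMeasurable
    (ae_of_all _ fun _ => (Circle.norm_coe _).le)

theorem integrable_mul_conj {α : Type*} {_ : MeasurableSpace α} {μ : Measure α} {u v : α → ℂ}
    (hu : MemLp u 2 μ) (hv : MemLp v 2 μ) : Integrable (fun x => u x * conj (v x)) μ :=
  hu.integrable_mul hv.star

end Preliminaries

/-! ### Parseval's identity on the unit cube -/

section UnitCube

variable {d : ℕ}

/-- The half-open unit cube with largest vertex `m`. The cubes partition `ℝᵈ`, and `cube 0` is the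
fundamental domain `(-1, 0]ᵈ` of `ℤᵈ`. -/
def cube (m : Fin d → ℤ) : Set (EuclideanSpace ℝ (Fin d)) := {x | ∀ i, ⌈x i⌉ = m i}

theorem measurableSet_cube (m : Fin d → ℤ) : MeasurableSet (cube m) := by
  rw [cube, Set.ofPred_forall]
  refine MeasurableSet.iInter fun i => ?_
  have hi : Measurable fun x : EuclideanSpace ℝ (Fin d) => x i := by fun_prop
  exact (Int.measurable_ceil.comp hi) (measurableSet_singleton (m i))

theorem pairwise_disjoint_cube : Pairwise (onFun Disjoint (cube (d := d))) := fun m m' h =>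
  Set.disjoint_left.mpr fun x hx hx' => h (funext fun i => by rw [← hx i, hx' i])

theorem iUnion_cube : ⋃ m, cube (d := d) m = Set.univ :=
  Set.eq_univ_of_forall fun x => Set.mem_iUnion.mpr ⟨fun i => ⌈x i⌉, fun _ => rfl⟩

theorem preimage_add_intVec_cube (m k : Fin d → ℤ) :
    (fun x => x + intVec k) ⁻¹' cube (m + k) = cube m := by
  ext x; simp [cube]

theorem norm_le_of_mem_cube_zero {x : EuclideanSpace ℝ (Fin d)} (hx : x ∈ cube 0) :
    ‖x‖ ≤ √d := by
  rw [EuclideanSpace.norm_eq]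
  refine Real.sqrt_le_sqrt ?_
  calc ∑ i, ‖x i‖ ^ 2 ≤ ∑ _i : Fin d, (1 : ℝ) := Finset.sum_le_sum fun i _ => ?_
    _ = d := by simp
  obtain ⟨h1, h2⟩ := Int.ceil_eq_iff.mp (hx i)
  rw [sq_le_one_iff_abs_le_one, Real.norm_eq_abs, abs_abs, abs_le]
  simp only [Pi.zero_apply, Int.cast_zero] at h1 h2
  constructor <;> linarith

theorem finite_setOf_cube_inter_nonempty {B : Set (EuclideanSpace ℝ (Fin d))} (hB : IsBounded B) :
    {m : Fin d → ℤ | (cube m ∩ B).Nonempty}.Finite := by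
  obtain ⟨R, hR⟩ := hB.exists_norm_le
  refine (Set.Finite.pi' fun _ : Fin d => Set.finite_Icc (-⌈R⌉) ⌈R⌉).subset ?_
  rintro m ⟨x, hxm, hxB⟩ i
  obtain ⟨h1, h2⟩ := abs_le.mp ((PiLp.norm_apply_le x i).trans (hR x hxB))
  rw [← hxm i]
  refine ⟨?_, Int.ceil_le_ceil h2⟩
  rw [neg_le, ← Int.floor_neg]
  exact (Int.floor_le_ceil _).trans (Int.ceil_le_ceil (neg_le.mp h1))

/-- The point of `cube 0` representing a point of the torus. -/
noncomputable def torusRep (t : UnitAddTorus (Fin d)) : EuclideanSpace ℝ (Fin d) :=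
  WithLp.toLp 2 (UnitAddTorus.measurableEquivPiIoc (fun _ => -1) t).1

theorem coe_torusRep (t : UnitAddTorus (Fin d)) (i : Fin d) :
    ((torusRep t i : ℝ) : UnitAddCircle) = t i := by
  have h := (UnitAddTorus.measurableEquivPiIoc (fun _ : Fin d => (-1 : ℝ))).symm_apply_apply t
  rw [UnitAddTorus.coe_symm_measurableEquivPiIoc_apply] at h
  exact congrFun h i

theorem measurePreserving_torusRep :
    MeasurePreserving (torusRep (d := d)) (Measure.pi fun _ => AddCircle.haarAddCircle)
      (volume.restrict (cube 0)) := by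
  let Q : Set (Fin d → ℝ) := {x | ∀ i, x i ∈ Set.Ioc (-1 : ℝ) (-1 + 1)}
  have hQ : MeasurableSet Q := MeasurableSet.univ_pi' fun _ => measurableSet_Ioc
  have hcube : WithLp.toLp 2 ⁻¹' cube (d := d) 0 = Q := by
    ext x
    simp [Q, cube, Int.ceil_eq_iff]
  have h := (PiLp.volume_preserving_toLp (Fin d)).restrict_preimage (measurableSet_cube 0)
  rw [hcube] at h
  exact h.comp ((measurePreserving_subtype_coe hQ).comp
    (UnitAddTorus.measurePreserving_equivPiIoc fun _ => -1))

instance isFiniteMeasure_restrict_cube_zero :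
    IsFiniteMeasure ((volume : Measure (EuclideanSpace ℝ (Fin d))).restrict (cube 0)) := by
  rw [← measurePreserving_torusRep.map_eq]
  infer_instance

theorem volume_cube_zero : volume (cube (d := d) 0) = 1 := by
  rw [← Measure.restrict_apply_univ, ← measurePreserving_torusRep.measure_preimage
    MeasurableSet.univ.nullMeasurableSet, Set.preimage_univ, measure_univ]

theorem mFourier_eq_fourierChar (n : Fin d → ℤ) (t : UnitAddTorus (Fin d)) :
    UnitAddTorus.mFourier n t = 𝐞 (inner ℝ (intVec n) (torusRep t)) := by
  rw [fourierChar_inner]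
  change ∏ i, fourier (n i) (t i) = _
  refine Finset.prod_congr rfl fun i _ => ?_
  rw [← coe_torusRep t i, fourier_coe_apply, Real.fourierChar_apply]
  congr 1
  push_cast [intVec_apply]
  ring

theorem integral_comp_torusRep {w : EuclideanSpace ℝ (Fin d) → ℂ}
    (hw : AEStronglyMeasurable w (volume.restrict (cube 0))) :
    ∫ t, w (torusRep t) ∂(Measure.pi fun _ => AddCircle.haarAddCircle) = ∫ x in cube 0, w x := by
  have hmp := measurePreserving_torusRep (d := d)
  rw [← hmp.map_eq, integral_map hmp.aemeasurable (by rwa [hmp.map_eq])]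

theorem mFourierCoeff_comp_torusRep {w : EuclideanSpace ℝ (Fin d) → ℂ}
    (hw : MemLp w 2 (volume.restrict (cube 0))) (z : Fin d → ℤ) :
    UnitAddTorus.mFourierCoeff
        ((hw.comp_measurePreserving measurePreserving_torusRep).toLp (w ∘ torusRep)) (-z) =
      ∫ x in cube 0, w x * 𝐞 (inner ℝ (intVec z) x) := by
  have hmp := measurePreserving_torusRep (d := d)
  rw [UnitAddTorus.mFourierCoeff,
    ← integral_comp_torusRep (w := fun x => w x * 𝐞 (inner ℝ (intVec z) x))
      (hw.1.mul (continuous_fourierChar_inner _).aestronglyMeasurable)]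
  refine integral_congr_ae ?_
  filter_upwards [(hw.comp_measurePreserving hmp).coeFn_toLp] with t ht
  rw [ht, neg_neg, mFourier_eq_fourierChar, smul_eq_mul, mul_comm, Function.comp_apply]

theorem hasSum_integral_cube_mul_conj {u v : EuclideanSpace ℝ (Fin d) → ℂ}
    (hu : MemLp u 2 (volume.restrict (cube 0))) (hv : MemLp v 2 (volume.restrict (cube 0))) :
    HasSum (fun z : Fin d → ℤ => (∫ x in cube 0, u x * 𝐞 (inner ℝ (intVec z) x)) *
      conj (∫ x in cube 0, v x * 𝐞 (inner ℝ (intVec z) x)))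
      (∫ x in cube 0, u x * conj (v x)) := by
  have hmp := measurePreserving_torusRep (d := d)
  have hU := hu.comp_measurePreserving hmp
  have hV := hv.comp_measurePreserving hmp
  have hparseval := (Equiv.neg (Fin d → ℤ)).hasSum_iff.mpr
    (UnitAddTorus.hasSum_prod_mFourierCoeff (hV.toLp (v ∘ torusRep)) (hU.toLp (u ∘ torusRep)))
  convert hparseval using 1
  · funext z
    rw [← mFourierCoeff_comp_torusRep hu, ← mFourierCoeff_comp_torusRep hv, mul_comm]
    rfl
  · rw [← integral_comp_torusRep (integrable_mul_conj hu hv).1]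
    refine integral_congr_ae ?_
    filter_upwards [hU.coeFn_toLp, hV.coeFn_toLp] with t h1 h2
    rw [h1, h2, mul_comm]
    rfl

end UnitCube

/-! ### Parseval's identity for lattices -/

section ChangeOfVariables

variable {E : Type*} [NormedAddCommGroup E] [NormedSpace ℝ E]

/-- The factor by which an invertible linear map scales volumes. -/
noncomputable def absDet (g : E ≃L[ℝ] E) : ℝ := |LinearMap.det (g : E →ₗ[ℝ] E)|

theorem absDet_pos (g : E ≃L[ℝ] E) : 0 < absDet g :=
  abs_pos.mpr (LinearEquiv.isUnit_det' g.toLinearEquiv).ne_zero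

variable [FiniteDimensional ℝ E] [MeasurableSpace E] [BorelSpace E] (g : E ≃L[ℝ] E)
  {μ : Measure E} [μ.IsAddHaarMeasure]

theorem map_equiv_addHaar : μ.map g = ENNReal.ofReal (absDet g)⁻¹ • μ := by
  rw [absDet, ← abs_inv]
  exact Measure.map_linearMap_addHaar_eq_smul_addHaar μ
    (LinearEquiv.isUnit_det' g.toLinearEquiv).ne_zero

theorem integral_comp_equiv {F : Type*} [NormedAddCommGroup F] [NormedSpace ℝ F] (f : E → F) :
    ∫ x, f (g x) ∂μ = (absDet g)⁻¹ • ∫ x, f x ∂μ := by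
  have hg : MeasurableEmbedding g := g.toHomeomorph.measurableEmbedding
  rw [← hg.integral_map, map_equiv_addHaar, integral_smul_measure,
    ENNReal.toReal_ofReal (inv_nonneg.mpr (absDet_pos g).le)]

theorem lintegral_comp_equiv (f : E → ℝ≥0∞) :
    ∫⁻ x, f (g x) ∂μ = ENNReal.ofReal (absDet g)⁻¹ * ∫⁻ x, f x ∂μ := by
  have hg : MeasurableEmbedding g := g.toHomeomorph.measurableEmbedding
  rw [← hg.lintegral_map, map_equiv_addHaar, lintegral_smul_measure,
    smul_eq_mul]

theorem quasiMeasurePreserving_equiv : Measure.QuasiMeasurePreserving g μ μ :=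
  ⟨g.continuous.measurable, by
    rw [map_equiv_addHaar]
    exact Measure.smul_absolutelyContinuous⟩

variable {g} in
theorem memLp_comp_equiv {F : Type*} [NormedAddCommGroup F] {p : ℝ≥0∞} {f : E → F}
    (hf : MemLp f p μ) : MemLp (f ∘ g) p μ := by
  refine MemLp.comp_of_map ?_ g.continuous.aemeasurable
  rw [map_equiv_addHaar]
  exact hf.smul_measure ENNReal.ofReal_ne_top

end ChangeOfVariables

theorem integrable_of_memLp_two_of_isBounded_support {E F : Type*} [PseudoMetricSpace E]
    [ProperSpace E] [MeasurableSpace E] {μ : Measure E} [IsFiniteMeasureOnCompacts μ]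
    [NormedAddCommGroup F] {u : E → F} (hu : MemLp u 2 μ) (hb : IsBounded (support u)) :
    Integrable u μ := by
  rw [← integrableOn_iff_integrable_of_support_subset (subset_closure : _ ⊆ closure (support u))]
  have : IsFiniteMeasure (μ.restrict (closure (support u))) :=
    isFiniteMeasure_restrict.mpr hb.isCompact_closure.measure_lt_top.ne
  exact (hu.restrict _).integrable one_le_two

section Lattice

variable {d : ℕ}

theorem exists_finset_forall_notMem_eq_zero {F : Type*} [Zero F]
    {u : EuclideanSpace ℝ (Fin d) → F} (hu : IsBounded (support u)) :
    ∃ S : Finset (Fin d → ℤ), ∀ m ∉ S, ∀ x ∈ cube 0, u (x + intVec m) = 0 := by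
  refine ⟨(finite_setOf_cube_inter_nonempty hu).toFinset, fun m hm x hx => ?_⟩
  rw [Set.Finite.mem_toFinset, Set.mem_ofPred_eq, Set.not_nonempty_iff_eq_empty] at hm
  rw [← preimage_add_intVec_cube 0 m, zero_add, Set.mem_preimage] at hx
  by_contra h
  exact Set.eq_empty_iff_forall_notMem.mp hm _ ⟨hx, h⟩

theorem integral_eq_sum_setIntegral_cube {w : EuclideanSpace ℝ (Fin d) → ℂ} (hw : Integrable w)
    {S : Finset (Fin d → ℤ)} (hS : ∀ m ∉ S, ∀ x ∈ cube 0, w (x + intVec m) = 0) :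
    ∫ x, w x = ∑ m ∈ S, ∫ x in cube 0, w (x + intVec m) := by
  have hcubes : HasSum (fun m : Fin d → ℤ => ∫ x in cube m, w x) (∫ x, w x) := by
    rw [← setIntegral_univ, ← iUnion_cube]
    exact hasSum_integral_iUnion measurableSet_cube pairwise_disjoint_cube hw.integrableOn
  have htranslate : ∀ m : Fin d → ℤ,
      ∫ x in cube m, w x = ∫ x in cube 0, w (x + intVec m) := fun m => by
    rw [← preimage_add_intVec_cube 0 m, zero_add]
    exact ((measurePreserving_add_right volume (intVec m)).setIntegral_preimage_emb
      (MeasurableEquiv.addRight (intVec m)).measurableEmbedding w _).symm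
  simp only [htranslate] at hcubes
  exact hcubes.unique (hasSum_sum_of_ne_finset_zero fun m hm =>
    setIntegral_eq_zero_of_forall_eq_zero (hS m hm))

theorem memLp_comp_add {w : EuclideanSpace ℝ (Fin d) → ℂ} (hw : MemLp w 2)
    (y : EuclideanSpace ℝ (Fin d)) : MemLp (fun x => w (x + y)) 2 :=
  hw.comp_measurePreserving (measurePreserving_add_right volume y)

theorem integral_mul_fourierChar_intVec_eq {w : EuclideanSpace ℝ (Fin d) → ℂ} (hw : Integrable w)
    {S : Finset (Fin d → ℤ)} (hS : ∀ m ∉ S, ∀ x ∈ cube 0, w (x + intVec m) = 0)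
    (z : Fin d → ℤ) :
    ∫ x, w x * 𝐞 (inner ℝ (intVec z) x) =
      ∫ x in cube 0, (∑ m ∈ S, w (x + intVec m)) * 𝐞 (inner ℝ (intVec z) x) := by
  rw [integral_eq_sum_setIntegral_cube (integrable_mul_fourierChar_inner hw _)
    fun m hm x hx => by rw [hS m hm x hx, zero_mul]]
  simp only [inner_add_right, AddChar.map_add_eq_mul, fourierChar_inner_intVec_intVec, mul_one,
    Finset.sum_mul]
  exact (integral_finsetSum _ fun m _ =>
    integrable_mul_fourierChar_inner (hw.comp_add_right _).integrableOn _).symm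

theorem hasSum_integral_mul_conj_add_intVec {u v : EuclideanSpace ℝ (Fin d) → ℂ}
    (hu : MemLp u 2) (hv : MemLp v 2) {S T : Finset (Fin d → ℤ)}
    (hS : ∀ m ∉ S, ∀ x ∈ cube 0, u (x + intVec m) = 0)
    (hT : ∀ m ∉ T, ∀ x ∈ cube 0, v (x + intVec m) = 0) :
    HasSum (fun k : Fin d → ℤ => ∫ x, u x * conj (v (x + intVec k)))
      (∫ x in cube 0, (∑ m ∈ S, u (x + intVec m)) * conj (∑ m ∈ T, v (x + intVec m))) := by
  have hint : ∀ m n : Fin d → ℤ, IntegrableOn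
      (fun x => u (x + intVec m) * conj (v (x + intVec n))) (cube 0) := fun m n =>
    (integrable_mul_conj (memLp_comp_add hu _) (memLp_comp_add hv _)).integrableOn
  have hexpand : ∫ x in cube 0, (∑ m ∈ S, u (x + intVec m)) * conj (∑ m ∈ T, v (x + intVec m)) =
      ∑ m ∈ S, ∑ n ∈ T, ∫ x in cube 0, u (x + intVec m) * conj (v (x + intVec n)) := by
    simp only [map_sum, Finset.sum_mul_sum]
    rw [integral_finsetSum _ fun m _ => integrable_finsetSum _ fun n _ => hint m n]
    exact Finset.sum_congr rfl fun m _ => integral_finsetSum _ fun n _ => hint m n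
  have hsplit : ∀ k : Fin d → ℤ, ∫ x, u x * conj (v (x + intVec k)) =
      ∑ m ∈ S, ∫ x in cube 0, u (x + intVec m) * conj (v (x + intVec (m + k))) := fun k => by
    rw [integral_eq_sum_setIntegral_cube (integrable_mul_conj hu (memLp_comp_add hv _))
      fun m hm x hx => by rw [hS m hm x hx, zero_mul]]
    simp only [intVec_add, add_assoc]
  simp only [hsplit, hexpand]
  refine hasSum_sum fun m _ => (Equiv.addLeft m).hasSum_iff.mpr
    (hasSum_sum_of_ne_finset_zero
      (f := fun n => ∫ x in cube 0, u (x + intVec m) * conj (v (x + intVec n))) fun n hn => ?_)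
  exact setIntegral_eq_zero_of_forall_eq_zero fun x hx => by rw [hT n hn x hx, map_zero, mul_zero]

theorem hasSum_integral_mul_fourierChar_intVec {u v : EuclideanSpace ℝ (Fin d) → ℂ}
    (hu : MemLp u 2) (hv : MemLp v 2) (hub : IsBounded (support u)) (hvb : IsBounded (support v)) :
    HasSum (fun z : Fin d → ℤ => (∫ x, u x * 𝐞 (inner ℝ (intVec z) x)) *
        conj (∫ x, v x * 𝐞 (inner ℝ (intVec z) x)))
      (∑' k : Fin d → ℤ, ∫ x, u x * conj (v (x + intVec k))) := by
  obtain ⟨S, hS⟩ := exists_finset_forall_notMem_eq_zero hub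
  obtain ⟨T, hT⟩ := exists_finset_forall_notMem_eq_zero hvb
  have hper : ∀ {w : EuclideanSpace ℝ (Fin d) → ℂ}, MemLp w 2 → ∀ U : Finset (Fin d → ℤ),
      MemLp (fun x => ∑ m ∈ U, w (x + intVec m)) 2 (volume.restrict (cube 0)) :=
    fun hw U => memLp_finsetSum U fun m _ => (memLp_comp_add hw _).restrict _
  rw [(hasSum_integral_mul_conj_add_intVec hu hv hS hT).tsum_eq]
  simp only [
    integral_mul_fourierChar_intVec_eq (integrable_of_memLp_two_of_isBounded_support hu hub) hS,
    integral_mul_fourierChar_intVec_eq (integrable_of_memLp_two_of_isBounded_support hv hvb) hT]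
  exact hasSum_integral_cube_mul_conj (hper hu S) (hper hv T)

theorem hasSum_integral_mul_fourierChar_lattice
    (g : EuclideanSpace ℝ (Fin d) ≃L[ℝ] EuclideanSpace ℝ (Fin d))
    {u v : EuclideanSpace ℝ (Fin d) → ℂ} (hu : MemLp u 2) (hv : MemLp v 2)
    (hub : IsBounded (support u)) (hvb : IsBounded (support v)) :
    HasSum (fun z : Fin d → ℤ => (absDet g : ℂ)⁻¹ *
        ((∫ x, u x * 𝐞 (inner ℝ (intVec z) (g.symm x))) *
          conj (∫ x, v x * 𝐞 (inner ℝ (intVec z) (g.symm x)))))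
      (∑' k : Fin d → ℤ, ∫ x, u x * conj (v (x + g (intVec k)))) := by
  have hg : (absDet g : ℂ) ≠ 0 := by exact_mod_cast (absDet_pos g).ne'
  have hsubst : ∀ f : EuclideanSpace ℝ (Fin d) → ℂ, ∫ x, f x = absDet g * ∫ x, f (g x) :=
    fun f => by
      rw [integral_comp_equiv g f, Complex.real_smul, Complex.ofReal_inv, mul_inv_cancel_left₀ hg]
  have hbdd : ∀ {w : EuclideanSpace ℝ (Fin d) → ℂ}, IsBounded (support w) →
      IsBounded (support (w ∘ g)) := fun hw => by
    rw [support_comp_eq_preimage, ← ContinuousLinearEquiv.image_symm_eq_preimage]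
    exact g.symm.lipschitz.isBounded_image hw
  have h := (hasSum_integral_mul_fourierChar_intVec (memLp_comp_equiv (g := g) hu)
    (memLp_comp_equiv (g := g) hv) (hbdd hub) (hbdd hvb)).mul_left (absDet g : ℂ)
  have hchar : ∀ (w : EuclideanSpace ℝ (Fin d) → ℂ) (z : Fin d → ℤ),
      ∫ x, w x * 𝐞 (inner ℝ (intVec z) (g.symm x)) =
        absDet g * ∫ x, w (g x) * 𝐞 (inner ℝ (intVec z) x) := fun w z => by
    rw [hsubst]
    simp only [g.symm_apply_apply]
  have hcorr : ∀ k : Fin d → ℤ, ∫ x, u x * conj (v (x + g (intVec k))) =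
      absDet g * ∫ x, u (g x) * conj (v (g (x + intVec k))) := fun k => by
    rw [hsubst]
    simp only [map_add]
  simp only [hchar, hcorr, tsum_mul_left]
  refine h.congr_fun fun z => ?_
  rw [map_mul, Complex.conj_ofReal, comp_def, comp_def]
  field_simp

end Lattice

/-! ### Expanding maps and lattice points in annuli -/

section Expanding

variable {E : Type*} [NormedAddCommGroup E]

/-- The closed annulus with radii `R⁻¹` and `R`; these sets exhaust the punctured space. -/
def annulus (R : ℝ) : Set E := {x | R⁻¹ ≤ ‖x‖ ∧ ‖x‖ ≤ R}

theorem measurableSet_annulus [MeasurableSpace E] [OpensMeasurableSpace E] (R : ℝ) :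
    MeasurableSet (annulus R : Set E) :=
  (measurableSet_le measurable_const measurable_norm).inter
    (measurableSet_le measurable_norm measurable_const)

theorem annulus_subset_closedBall (R : ℝ) : (annulus R : Set E) ⊆ Metric.closedBall 0 R :=
  fun _ hx => mem_closedBall_zero_iff.mpr hx.2

theorem annulus_subset_annulus {R S : ℝ} (hR : 0 < R) (h : R ≤ S) :
    (annulus R : Set E) ⊆ annulus S :=
  fun _ hx => ⟨(inv_anti₀ hR h).trans hx.1, hx.2.trans h⟩

variable [NormedSpace ℝ E]

/-- The negative powers of `b` tend to zero in norm; for a matrix, this is expansiveness. -/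
def IsExpanding (b : E ≃L[ℝ] E) : Prop :=
  Tendsto (fun n : ℕ => ‖((b ^ (-(n : ℤ)) : E ≃L[ℝ] E) : E →L[ℝ] E)‖) atTop (𝓝 0)

variable {b : E ≃L[ℝ] E}

theorem zpow_add_apply (b : E ≃L[ℝ] E) (m n : ℤ) (x : E) : (b ^ (m + n)) x = (b ^ m) ((b ^ n) x) :=
  DFunLike.congr_fun (zpow_add b m n) x

theorem zpow_neg_apply_zpow (b : E ≃L[ℝ] E) (n : ℤ) (x : E) : (b ^ (-n)) ((b ^ n) x) = x := by
  rw [← zpow_add_apply, neg_add_cancel, zpow_zero]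
  rfl

namespace IsExpanding

theorem exists_norm_zpow_neg_le (hb : IsExpanding b) {δ : ℝ} (hδ : 0 < δ) :
    ∃ N : ℕ, ∀ n ≥ N, ∀ x, ‖(b ^ (-(n : ℤ))) x‖ ≤ δ * ‖x‖ := by
  obtain ⟨N, hN⟩ := eventually_atTop.mp (hb.eventually_le_const hδ)
  exact ⟨N, fun n hn => ContinuousLinearMap.le_of_opNorm_le _ (hN n hn)⟩

theorem exists_norm_zpow_le (hb : IsExpanding b) (N : ℤ) :
    ∃ c : ℝ, ∀ n ≤ N, ∀ x, ‖(b ^ n) x‖ ≤ c * ‖x‖ := by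
  obtain ⟨c, hc⟩ := hb.bddAbove_range
  refine ⟨c * ‖((b ^ N : E ≃L[ℝ] E) : E →L[ℝ] E)‖, fun n hn x => ?_⟩
  obtain ⟨m, hm⟩ := Int.eq_ofNat_of_zero_le (sub_nonneg.mpr hn)
  have hc' := hc ⟨m, rfl⟩
  rw [show n = -(m : ℤ) + N by omega, zpow_add_apply, mul_assoc]
  exact (ContinuousLinearMap.le_of_opNorm_le _ hc' _).trans
    (mul_le_mul_of_nonneg_left (((b ^ N : E ≃L[ℝ] E) : E →L[ℝ] E).le_opNorm x)
      ((norm_nonneg _).trans hc'))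

theorem exists_sub_lt_of_mem_annulus (hb : IsExpanding b) {R : ℝ} (hR : 0 < R) :
    ∃ N : ℕ, ∀ x, ∀ m n : ℤ, (b ^ m) x ∈ annulus R → (b ^ n) x ∈ annulus R → n - m < N := by
  obtain ⟨N, hN⟩ := hb.exists_norm_zpow_neg_le (δ := (2 * R ^ 2)⁻¹) (by positivity)
  refine ⟨N, fun x m n hm hn => ?_⟩
  by_contra! hlt
  obtain ⟨k, hk⟩ := Int.eq_ofNat_of_zero_le (N.cast_nonneg.trans hlt)
  have hcontract := hN k (by omega) ((b ^ n) x)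
  rw [← zpow_add_apply, show -(k : ℤ) + n = m by omega] at hcontract
  have hsmall : R⁻¹ ≤ R⁻¹ / 2 := calc
    R⁻¹ ≤ (2 * R ^ 2)⁻¹ * R := hm.1.trans (hcontract.trans (by gcongr; exact hn.2))
    _ = R⁻¹ / 2 := by field_simp
  linarith [inv_pos.mpr hR]

theorem exists_tsum_indicator_annulus_le (hb : IsExpanding b) {R : ℝ} (hR : 0 < R) :
    ∃ K : ℕ, ∀ x, ∑' n : ℤ, (annulus R).indicator (1 : E → ℝ≥0∞) ((b ^ n) x) ≤ K := by
  obtain ⟨N, hN⟩ := hb.exists_sub_lt_of_mem_annulus hR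
  refine ⟨2 * N + 1, fun x => ?_⟩
  by_cases hne : ∃ n₀ : ℤ, (b ^ n₀) x ∈ annulus R
  · obtain ⟨n₀, hn₀⟩ := hne
    rw [tsum_eq_sum (s := Finset.Icc (n₀ - N) (n₀ + N)) fun n hn =>
      Set.indicator_of_notMem (fun h => hn ?_) _]
    · refine (Finset.sum_le_card_nsmul _ _ (1 : ℝ≥0∞) fun n _ =>
        Set.indicator_le_self' (f := (1 : E → ℝ≥0∞)) (fun _ _ => zero_le) _).trans ?_
      rw [Int.card_Icc, nsmul_eq_mul, mul_one]
      exact_mod_cast (by omega : (n₀ + N + 1 - (n₀ - N)).toNat ≤ 2 * N + 1)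
    · have hle := hN x n n₀ h hn₀
      have hge := hN x n₀ n hn₀ h
      exact Finset.mem_Icc.mpr ⟨by omega, by omega⟩
  · push Not at hne
    simp [Set.indicator_of_notMem (hne _)]

theorem exists_lt_norm_zpow_intVec {d : ℕ}
    {b : EuclideanSpace ℝ (Fin d) ≃L[ℝ] EuclideanSpace ℝ (Fin d)} (hb : IsExpanding b) {R : ℝ}
    (hR : 0 < R) :
    ∃ N : ℤ, ∀ n ≥ N, ∀ k : Fin d → ℤ, k ≠ 0 → R < ‖(b ^ n) (intVec k)‖ := by
  obtain ⟨N, hN⟩ := hb.exists_norm_zpow_neg_le (δ := (2 * R)⁻¹) (by positivity)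
  refine ⟨N, fun n hn k hk => ?_⟩
  lift n to ℕ using by omega
  have h := (one_le_norm_intVec hk).trans
    (zpow_neg_apply_zpow b n (intVec k) ▸ hN n (by exact_mod_cast hn) _)
  rw [← div_eq_inv_mul, one_le_div (by positivity)] at h
  linarith

end IsExpanding

end Expanding

section Counting

variable {d : ℕ}

theorem tsum_indicator_annulus_le
    (g : EuclideanSpace ℝ (Fin d) ≃L[ℝ] EuclideanSpace ℝ (Fin d)) {c : ℝ}
    (hc : ∀ x, ‖g x‖ ≤ c * ‖x‖) (R : ℝ) (y : EuclideanSpace ℝ (Fin d)) :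
    ∑' k : Fin d → ℤ, (annulus R).indicator (1 : EuclideanSpace ℝ (Fin d) → ℝ≥0∞)
        (y + g (intVec k)) ≤
      volume (Metric.closedBall (0 : EuclideanSpace ℝ (Fin d)) (R + |c| * √d)) *
        ENNReal.ofReal (absDet g)⁻¹ := by
  set B := Metric.closedBall (0 : EuclideanSpace ℝ (Fin d)) (R + |c| * √d)
  have hvol : ∀ k : Fin d → ℤ, volume (cube k) = 1 := fun k => by
    rw [← zero_add k, ← (measurePreserving_add_right volume (intVec k)).measure_preimage
      (measurableSet_cube _).nullMeasurableSet, preimage_add_intVec_cube, volume_cube_zero]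
  have hball : ∀ k : Fin d → ℤ, y + g (intVec k) ∈ annulus R → ∀ x ∈ cube k, y + g x ∈ B :=
    fun k hk x hx => by
      have hsub : x - intVec k ∈ cube 0 := by
        rw [← preimage_add_intVec_cube 0 k, zero_add, Set.mem_preimage, sub_add_cancel]
        exact hx
      have hgsub : ‖g (x - intVec k)‖ ≤ |c| * √d := (hc _).trans (mul_le_mul (le_abs_self c)
        (norm_le_of_mem_cube_zero hsub) (norm_nonneg _) (abs_nonneg c))
      rw [mem_closedBall_zero_iff, ← add_sub_cancel (intVec k) x, map_add, ← add_assoc]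
      exact (norm_add_le _ _).trans (add_le_add hk.2 hgsub)
  have hterm : ∀ k : Fin d → ℤ, (annulus R).indicator 1 (y + g (intVec k)) ≤
      ∫⁻ x in cube k, B.indicator 1 (y + g x) := fun k => by
    by_cases hk : y + g (intVec k) ∈ annulus R
    · rw [Set.indicator_of_mem hk, Pi.one_apply, ← hvol k, ← setLIntegral_one]
      exact setLIntegral_mono' (measurableSet_cube k) fun x hx => by
        rw [Set.indicator_of_mem (hball k hk x hx), Pi.one_apply]
    · rw [Set.indicator_of_notMem hk]
      exact zero_le
  calc ∑' k : Fin d → ℤ, (annulus R).indicator 1 (y + g (intVec k))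
      ≤ ∑' k : Fin d → ℤ, ∫⁻ x in cube k, B.indicator 1 (y + g x) := ENNReal.tsum_le_tsum hterm
    _ = ∫⁻ x, B.indicator 1 (y + g x) := by
      rw [← lintegral_iUnion measurableSet_cube pairwise_disjoint_cube, iUnion_cube,
        setLIntegral_univ]
    _ = volume B * ENNReal.ofReal (absDet g)⁻¹ := by
      rw [lintegral_comp_equiv g (fun x => B.indicator 1 (y + x)),
        lintegral_add_left_eq_self (B.indicator 1) y,
        lintegral_indicator_one Metric.isClosed_closedBall.measurableSet, mul_comm]

end Counting

/-! ### The local integrability condition -/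

section LocalIntegrability

variable {E : Type*} [NormedAddCommGroup E] [MeasureSpace E]

/-- The energy of `w` on the part of an annulus which the shift by `p` keeps in the annulus. -/
noncomputable def overlapEnergy (R : ℝ) (w : E → ℂ) (p : E) : ℝ≥0∞ :=
  ∫⁻ x in annulus R ∩ (fun x => x + p) ⁻¹' annulus R, ‖w x‖ₑ ^ 2

theorem overlapEnergy_eq_zero {R : ℝ} {p : E} (hp : 2 * R < ‖p‖) (w : E → ℂ) :
    overlapEnergy R w p = 0 := by
  suffices annulus R ∩ (fun x => x + p) ⁻¹' annulus R = ∅ by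
    rw [overlapEnergy, this, setLIntegral_empty]
  refine Set.eq_empty_iff_forall_notMem.mpr fun x hx => ?_
  have h := norm_sub_le (x + p) x
  rw [add_sub_cancel_left] at h
  linarith [hx.1.2, hx.2.2]

theorem tsum_overlapEnergy_le [BorelSpace E] {ι : Type*} [Countable ι] {p : ι → E} {R : ℝ}
    {K : ℝ≥0∞} (hp : ∀ y, ∑' i, (annulus R).indicator (1 : E → ℝ≥0∞) (y + p i) ≤ K) {w : E → ℂ}
    (hw : AEMeasurable w) :
    ∑' i, overlapEnergy R w (p i) ≤ K * ∫⁻ x in annulus R, ‖w x‖ₑ ^ 2 := by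
  have hw2 : AEMeasurable (fun x => ‖w x‖ₑ ^ 2) (volume.restrict (annulus R)) :=
    (hw.enorm.pow_const 2).restrict
  have hshift : ∀ i, Measurable fun x : E => (annulus R).indicator (1 : E → ℝ≥0∞) (x + p i) :=
    fun i => (measurable_one.indicator (measurableSet_annulus R)).comp (measurable_add_const _)
  calc ∑' i, overlapEnergy R w (p i)
      = ∑' i, ∫⁻ x in annulus R, (annulus R).indicator 1 (x + p i) * ‖w x‖ₑ ^ 2 := by
        refine tsum_congr fun i => ?_
        rw [overlapEnergy, Set.inter_comm, ← Measure.restrict_restrict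
          ((measurable_add_const _) (measurableSet_annulus R)),
          ← lintegral_indicator ((measurable_add_const _) (measurableSet_annulus R))]
        refine lintegral_congr fun x => ?_
        by_cases hx : x + p i ∈ annulus R <;> simp [hx]
    _ = ∫⁻ x in annulus R, (∑' i, (annulus R).indicator 1 (x + p i)) * ‖w x‖ₑ ^ 2 := by
        simp only [← ENNReal.tsum_mul_right]
        exact (lintegral_tsum fun i => (hshift i).aemeasurable.mul hw2).symm
    _ ≤ ∫⁻ x in annulus R, K * ‖w x‖ₑ ^ 2 := by
        gcongr with x
        exact hp x
    _ = K * ∫⁻ x in annulus R, ‖w x‖ₑ ^ 2 := lintegral_const_mul'' _ hw2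

variable {M : Type*}

/-- The local integrability condition of Hernández, Labate and Weiss for windows `w m` and sets of
frequency shifts `Λ m`. -/
def LocallyIntegrableSystem (Λ : M → Set E) (w : M → E → ℂ) : Prop :=
  ∀ R > 0, ∑' q : M × E, (Λ q.1).indicator (overlapEnergy R (w q.1)) q.2 < ∞

theorem LocallyIntegrableSystem.mono {Λ Λ' : M → Set E} {w : M → E → ℂ}
    (h : LocallyIntegrableSystem Λ w) (hΛ : ∀ m, Λ' m ⊆ Λ m) : LocallyIntegrableSystem Λ' w :=
  fun R hR => (ENNReal.tsum_le_tsum fun q : M × E =>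
    Set.indicator_le_indicator_of_subset (hΛ q.1) (fun _ => zero_le) q.2).trans_lt (h R hR)

variable {d : ℕ}

/-- The lattice `g ℤᵈ`. -/
def lattice (g : EuclideanSpace ℝ (Fin d) ≃L[ℝ] EuclideanSpace ℝ (Fin d)) :
    Set (EuclideanSpace ℝ (Fin d)) :=
  Set.range fun k => g (intVec k)

theorem tsum_indicator_lattice {α : Type*} [AddCommMonoid α] [TopologicalSpace α]
    (g : EuclideanSpace ℝ (Fin d) ≃L[ℝ] EuclideanSpace ℝ (Fin d))
    (f : EuclideanSpace ℝ (Fin d) → α) :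
    ∑' p, (lattice g).indicator f p = ∑' k, f (g (intVec k)) := by
  rw [← tsum_subtype]
  exact tsum_range f (g.injective.comp intVec_injective)

theorem neg_mem_lattice {g : EuclideanSpace ℝ (Fin d) ≃L[ℝ] EuclideanSpace ℝ (Fin d)}
    {p : EuclideanSpace ℝ (Fin d)} (hp : p ∈ lattice g) : -p ∈ lattice g := by
  obtain ⟨k, rfl⟩ := hp
  exact ⟨-k, by simp only [intVec_neg, map_neg]⟩

theorem zero_mem_lattice (g : EuclideanSpace ℝ (Fin d) ≃L[ℝ] EuclideanSpace ℝ (Fin d)) :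
    0 ∈ lattice g :=
  ⟨0, by simp⟩

variable {b : EuclideanSpace ℝ (Fin d) ≃L[ℝ] EuclideanSpace ℝ (Fin d)}

theorem IsExpanding.exists_tsum_overlapEnergy_le (hb : IsExpanding b) {R : ℝ} (hR : 0 < R) :
    ∃ C < ∞, ∀ ψ : EuclideanSpace ℝ (Fin d) → ℂ, MemLp ψ 2 → ∀ n : ℤ,
      ∑' p, (lattice (b ^ n) \ {0}).indicator (overlapEnergy R (ψ ∘ (b ^ (-n) :))) p ≤
        C * ∫⁻ x, (annulus R).indicator 1 ((b ^ n) x) * ‖ψ x‖ₑ ^ 2 := by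
  obtain ⟨N, hN⟩ := hb.exists_lt_norm_zpow_intVec (R := 2 * R) (by positivity)
  obtain ⟨c, hc⟩ := hb.exists_norm_zpow_le N
  refine ⟨volume (Metric.closedBall (0 : EuclideanSpace ℝ (Fin d)) (R + |c| * √d)),
    measure_closedBall_lt_top, fun ψ hψ n => ?_⟩
  rcases le_or_gt N n with hn | hn
  · refine (ENNReal.tsum_eq_zero.mpr fun p => Set.indicator_apply_eq_zero.mpr ?_).trans_le zero_le
    rintro ⟨⟨k, rfl⟩, hk⟩
    exact overlapEnergy_eq_zero (hN n hn k fun h => hk (by simp [h])) _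
  · calc ∑' p, (lattice (b ^ n) \ {0}).indicator (overlapEnergy R (ψ ∘ (b ^ (-n) :))) p
        ≤ ∑' p, (lattice (b ^ n)).indicator (overlapEnergy R (ψ ∘ (b ^ (-n) :))) p :=
          ENNReal.tsum_le_tsum fun p => Set.indicator_le_indicator_of_subset Set.sdiff_subset
            (fun _ => zero_le) p
      _ ≤ _ * ENNReal.ofReal (absDet (b ^ n))⁻¹ * ∫⁻ x in annulus R, ‖ψ ((b ^ (-n)) x)‖ₑ ^ 2 := by
          rw [tsum_indicator_lattice]
          exact tsum_overlapEnergy_le (tsum_indicator_annulus_le (b ^ n) (hc n hn.le) R)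
            (memLp_comp_equiv hψ).aestronglyMeasurable.aemeasurable
      _ = _ * ∫⁻ x, (annulus R).indicator 1 ((b ^ n) x) * ‖ψ x‖ₑ ^ 2 := by
          rw [mul_assoc, ← lintegral_indicator (measurableSet_annulus R), ← lintegral_comp_equiv]
          congr 2 with x
          by_cases hx : (b ^ n) x ∈ annulus R <;> simp [hx, zpow_neg_apply_zpow, -zpow_neg]

theorem IsExpanding.locallyIntegrableSystem (hb : IsExpanding b)
    {ψ : EuclideanSpace ℝ (Fin d) → ℂ} (hψ : MemLp ψ 2) :
    LocallyIntegrableSystem (fun n : ℤ => lattice (b ^ n) \ {0}) fun n => ψ ∘ (b ^ (-n) :) := by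
  intro R hR
  obtain ⟨C, hC, hlayer⟩ := hb.exists_tsum_overlapEnergy_le hR
  obtain ⟨K, hK⟩ := hb.exists_tsum_indicator_annulus_le hR
  have hψ2 : AEMeasurable fun x => ‖ψ x‖ₑ ^ 2 :=
    hψ.aestronglyMeasurable.enorm.pow_const 2
  have hfin : ∫⁻ x, ‖ψ x‖ₑ ^ 2 < ∞ := by
    simpa using lintegral_rpow_enorm_lt_top_of_eLpNorm_lt_top (by simp) (by simp) hψ.2
  have horbit : ∀ n : ℤ, Measurable fun x =>
      (annulus R).indicator (1 : EuclideanSpace ℝ (Fin d) → ℝ≥0∞) ((b ^ n) x) := fun n =>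
    (measurable_one.indicator (measurableSet_annulus R)).comp (b ^ n).continuous.measurable
  rw [ENNReal.tsum_prod (f := fun (n : ℤ) p =>
    (lattice (b ^ n) \ {0}).indicator (overlapEnergy R (ψ ∘ (b ^ (-n) :))) p)]
  calc _ ≤ ∑' n : ℤ, C * ∫⁻ x, (annulus R).indicator 1 ((b ^ n) x) * ‖ψ x‖ₑ ^ 2 :=
        ENNReal.tsum_le_tsum (hlayer ψ hψ)
    _ = C * ∫⁻ x, (∑' n : ℤ, (annulus R).indicator 1 ((b ^ n) x)) * ‖ψ x‖ₑ ^ 2 := by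
        simp only [ENNReal.tsum_mul_left, ← ENNReal.tsum_mul_right]
        exact congrArg _ (lintegral_tsum fun n => (horbit n).aemeasurable.mul hψ2).symm
    _ ≤ C * ∫⁻ x, K * ‖ψ x‖ₑ ^ 2 := by
        gcongr with x
        exact hK x
    _ < ∞ := by
        rw [lintegral_const_mul'' _ hψ2]
        exact ENNReal.mul_lt_top hC (ENNReal.mul_lt_top (ENNReal.natCast_lt_top K) hfin)

end LocalIntegrability

/-! ### Bessel sequences -/

section BesselSequences

variable {H : Type*} [NormedAddCommGroup H] [InnerProductSpace ℂ H] {J K : Type*}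

theorem isBessel_comp_equiv_iff (e : K ≃ J) {X : J → H} : IsBessel (X ∘ e) ↔ IsBessel X := by
  refine exists_congr fun C => and_congr_right fun _ => forall_congr' fun v => ?_
  rw [← e.summable_iff, ← e.tsum_eq fun j => ‖inner ℂ (X j) v‖ ^ 2]
  rfl

theorem isOrthogonal_comp_equiv_iff (e : K ≃ J) {X Y : J → H} :
    IsOrthogonal (X ∘ e) (Y ∘ e) ↔ IsOrthogonal X Y :=
  and_congr (isBessel_comp_equiv_iff e) <| and_congr (isBessel_comp_equiv_iff e) <|
    forall_congr' fun v => e.hasSum_iff (f := fun j => inner ℂ (X j) v • Y j)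

theorem isBessel_zero : IsBessel (0 : J → H) :=
  ⟨1, one_pos, fun v => by simp [summable_zero]⟩

theorem isOrthogonal_zero : IsOrthogonal (0 : J → H) 0 :=
  ⟨isBessel_zero, isBessel_zero, fun v => by simp [hasSum_zero]⟩

theorem isBessel_of_dense {X : J → H} {D : Set H} (hD : Dense D) {C : ℝ} (hC : 0 < C)
    (h : ∀ f ∈ D, ∀ s : Finset J, ∑ j ∈ s, ‖inner ℂ (X j) f‖ ^ 2 ≤ C * ‖f‖ ^ 2) :
    IsBessel X := by
  have hbound : ∀ f, ∀ s : Finset J, ∑ j ∈ s, ‖inner ℂ (X j) f‖ ^ 2 ≤ C * ‖f‖ ^ 2 := fun f s =>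
    hD.induction (P := fun f => ∑ j ∈ s, ‖inner ℂ (X j) f‖ ^ 2 ≤ C * ‖f‖ ^ 2)
      (fun f hf => h f hf s) (isClosed_le (by fun_prop) (by fun_prop)) f
  refine ⟨C, hC, fun v => ?_⟩
  have hsum : Summable fun j => ‖inner ℂ (X j) v‖ ^ 2 :=
    summable_of_sum_le (fun j => by positivity) (hbound v)
  exact ⟨hsum, hsum.tsum_le_of_sum_le (hbound v)⟩

namespace IsBessel

variable {X Y : J → H}

theorem memℓp (hX : IsBessel X) (v : H) : Memℓp (fun j => inner ℂ (X j) v) 2 := by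
  obtain ⟨C, -, h⟩ := hX
  exact memℓp_gen (by simpa using (h v).1)

theorem exists_analysis (hX : IsBessel X) :
    ∃ T : H →L[ℂ] lp (fun _ : J => ℂ) 2, ∀ v j, T v j = inner ℂ (X j) v := by
  obtain ⟨C, hC, h⟩ := id hX
  let T : H →ₗ[ℂ] lp (fun _ : J => ℂ) 2 :=
    { toFun := fun v => ⟨fun j => inner ℂ (X j) v, hX.memℓp v⟩
      map_add' := fun v w => by ext j; exact inner_add_right _ _ _
      map_smul' := fun c v => by ext j; exact inner_smul_right _ _ _ }
  have hT : ∀ v, ‖T v‖ ^ 2 = ∑' j, ‖inner ℂ (X j) v‖ ^ 2 := fun v => by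
    have hnorm := lp.norm_rpow_eq_tsum (p := 2) (by norm_num) (T v)
    simp only [ENNReal.toReal_ofNat, Real.rpow_ofNat] at hnorm
    exact hnorm
  refine ⟨T.mkContinuous √C fun v => le_of_sq_le_sq ?_ (by positivity), fun v j => rfl⟩
  rw [mul_pow, Real.sq_sqrt hC.le, hT]
  exact (h v).2

theorem exists_gramian [CompleteSpace H] (hX : IsBessel X) (hY : IsBessel Y) :
    ∃ S : H →L[ℂ] H, ∀ v, HasSum (fun j => inner ℂ (X j) v • Y j) (S v) := by
  classical
  obtain ⟨T, hT⟩ := hX.exists_analysis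
  obtain ⟨U, hU⟩ := hY.exists_analysis
  refine ⟨U.adjoint ∘L T, fun v => ?_⟩
  refine ((lp.hasSum_single (by norm_num : (2 : ℝ≥0∞) ≠ ∞) (T v)).mapL U.adjoint).congr_fun
    fun j => ext_inner_left ℂ fun w => ?_
  rw [ContinuousLinearMap.adjoint_inner_right, lp.inner_single_right, hU, hT, inner_smul_right,
    RCLike.inner_apply, inner_conj_symm]

theorem isOrthogonal_iff_of_dense [CompleteSpace H] (hX : IsBessel X) (hY : IsBessel Y)
    {D : Set H} (hD : Dense D) :
    IsOrthogonal X Y ↔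
      ∀ f ∈ D, ∀ g ∈ D, HasSum (fun j => inner ℂ (X j) f * inner ℂ g (Y j)) 0 := by
  obtain ⟨S, hS⟩ := hX.exists_gramian hY
  have hSfg : ∀ f g, HasSum (fun j => inner ℂ (X j) f * inner ℂ g (Y j)) (inner ℂ g (S f)) :=
    fun f g => by simpa [inner_smul_right] using (hS f).mapL (innerSL ℂ g)
  refine ⟨fun h f _ g _ => ?_, fun h => ⟨hX, hY, fun v => ?_⟩⟩
  · rw [← inner_zero_right g, ← (hS f).unique (h.2.2 f)]
    exact hSfg f g
  · have hzero : ∀ f ∈ D, S f = 0 := fun f hf =>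
      hD.eq_zero_of_inner_right ℂ fun g hg => (hSfg f g).unique (h f hf g hg)
    rw [← show S v = 0 from congrFun (S.continuous.ext_on hD continuous_const hzero) v]
    exact hS v

theorem summable_inner_mul_inner [CompleteSpace H] (hX : IsBessel X) (hY : IsBessel Y) (f g : H) :
    Summable fun j => inner ℂ (X j) f * inner ℂ g (Y j) := by
  obtain ⟨S, hS⟩ := hX.exists_gramian hY
  simpa [inner_smul_right] using ((hS f).mapL (innerSL ℂ g)).summable

end IsBessel

end BesselSequences

/-! ### Almost periodic series -/

section AlmostPeriodic

variable {d : ℕ}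

@[simp]
theorem norm_fourierChar (t : ℝ) : ‖(𝐞 t : ℂ)‖ = 1 := Circle.norm_coe _

/-- The average of `f` over the integer points of `[0, M)ᵈ`, which is `0` for `M = 0 < d`. -/
noncomputable def boxAverage (f : (Fin d → ℤ) → ℂ) (M : ℕ) : ℂ :=
  ((M : ℂ) ^ d)⁻¹ *
    ∑ w ∈ Fintype.piFinset fun _ => (Finset.range M).map Nat.castEmbedding, f w

theorem norm_boxAverage_le {f : (Fin d → ℤ) → ℂ} {C : ℝ} (hf : ∀ w, ‖f w‖ ≤ C) (M : ℕ) :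
    ‖boxAverage f M‖ ≤ C := by
  have hC : 0 ≤ C := (norm_nonneg _).trans (hf 0)
  rw [boxAverage, norm_mul, norm_inv, norm_pow, Complex.norm_natCast]
  refine inv_mul_le_of_le_mul₀ (by positivity) hC ((norm_sum_le_of_le _ fun w _ => hf w).trans ?_)
  simp

theorem boxAverage_tsum {J : Type*} {f : (Fin d → ℤ) → J → ℂ} (hf : ∀ w, Summable (f w)) (M : ℕ) :
    boxAverage (fun w => ∑' j, f w j) M = ∑' j, boxAverage (fun w => f w j) M := by
  simp only [boxAverage]
  rw [← Summable.tsum_finsetSum fun w _ => hf w, tsum_mul_left]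

theorem boxAverage_prod (f : Fin d → ℤ → ℂ) (M : ℕ) :
    boxAverage (fun w => ∏ i, f i (w i)) M =
      ∏ i, ((M : ℂ)⁻¹ * ∑ m ∈ Finset.range M, f i m) := by
  rw [boxAverage, Finset.prod_mul_distrib, Finset.prod_const, Finset.card_univ, Fintype.card_fin,
    inv_pow, ← Finset.prod_univ_sum]
  simp only [Finset.sum_map, Nat.castEmbedding_apply]

theorem tendsto_average_pow {c : ℂ} (hc : ‖c‖ = 1) [Decidable (c = 1)] :
    Tendsto (fun M : ℕ => (M : ℂ)⁻¹ * ∑ m ∈ Finset.range M, c ^ m) atTop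
      (𝓝 (if c = 1 then 1 else 0)) := by
  split_ifs with h
  · refine tendsto_const_nhds.congr' ?_
    filter_upwards [eventually_ne_atTop 0] with M hM
    simp [h, hM]
  · have hbound : ∀ M : ℕ, ‖(M : ℂ)⁻¹ * ∑ m ∈ Finset.range M, c ^ m‖ ≤
        (M : ℝ)⁻¹ * (2 / ‖c - 1‖) := fun M => by
      rw [geom_sum_eq h, norm_mul, norm_inv, Complex.norm_natCast, norm_div]
      gcongr
      calc ‖c ^ M - 1‖ ≤ ‖c ^ M‖ + ‖(1 : ℂ)‖ := norm_sub_le _ _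
        _ = 2 := by rw [norm_pow, hc, one_pow, norm_one, one_add_one_eq_two]
    refine squeeze_zero_norm hbound ?_
    simpa using (tendsto_inv_atTop_nhds_zero_nat (𝕜 := ℝ)).mul_const (2 / ‖c - 1‖)

theorem mem_range_intVec_iff (p : EuclideanSpace ℝ (Fin d)) :
    p ∈ Set.range intVec ↔ ∀ i, (𝐞 (p i) : ℂ) = 1 := by
  simp only [Circle.coe_eq_one, fourierChar_eq_one_iff]
  refine ⟨fun ⟨z, hz⟩ i => ⟨z i, by rw [← hz, intVec_apply]⟩, fun h => ?_⟩
  choose z hz using h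
  exact ⟨z, by ext i; exact hz i⟩

open Classical in
theorem tendsto_boxAverage_fourierChar (p : EuclideanSpace ℝ (Fin d)) :
    Tendsto (boxAverage fun w => (𝐞 (inner ℝ (intVec w) p) : ℂ)) atTop
      (𝓝 (if p ∈ Set.range intVec then 1 else 0)) := by
  have hpow : ∀ (m : ℕ) (t : ℝ), (𝐞 (m * t) : ℂ) = (𝐞 t : ℂ) ^ m := fun m t => by
    rw [← nsmul_eq_mul, AddChar.map_nsmul_eq_pow, Circle.coe_pow]
  have hlim := tendsto_finsetProd Finset.univ fun i _ =>
    tendsto_average_pow (norm_fourierChar (p i))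
  rw [Finset.prod_ite_zero, Finset.prod_const_one] at hlim
  simp only [Finset.mem_univ, true_imp_iff, ← mem_range_intVec_iff, ← hpow] at hlim
  refine hlim.congr fun M => ?_
  simp only [fourierChar_inner, intVec_apply]
  exact (boxAverage_prod (fun i m => (𝐞 (m * p i) : ℂ)) M).symm

theorem summable_mul_fourierChar {J : Type*} {c : J → ℂ} (hc : Summable c) (t : J → ℝ) :
    Summable fun j => c j * 𝐞 (t j) :=
  .of_norm (by simpa using hc.norm)

open Classical in
theorem tendsto_boxAverage_tsum {J : Type*} {c : J → ℂ} (hc : Summable c)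
    (p : J → EuclideanSpace ℝ (Fin d)) :
    Tendsto (boxAverage fun w => ∑' j, c j * 𝐞 (inner ℝ (intVec w) (p j))) atTop
      (𝓝 (∑' j, if p j ∈ Set.range intVec then c j else 0)) := by
  have havg : ∀ j M, boxAverage (fun w => c j * 𝐞 (inner ℝ (intVec w) (p j))) M =
      c j * boxAverage (fun w => (𝐞 (inner ℝ (intVec w) (p j)) : ℂ)) M := fun j M => by
    rw [boxAverage, boxAverage, ← Finset.mul_sum, mul_left_comm]
  refine (tendsto_congr (boxAverage_tsum fun w => summable_mul_fourierChar hc _)).mpr ?_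
  refine tendsto_tsum_of_dominated_convergence hc.norm (fun j => ?_)
    (Eventually.of_forall fun M j => norm_boxAverage_le (fun w => by simp) M)
  simpa [havg] using (tendsto_boxAverage_fourierChar (p j)).const_mul (c j)

theorem exists_forall_smul_notMem_range_intVec {S : Set (EuclideanSpace ℝ (Fin d))}
    (hS : S.Countable) : ∃ t : ℝ, ∀ p ∈ S, p ≠ 0 → t • p ∉ Set.range intVec := by
  have hbad : (⋃ p ∈ S \ {0}, ⋃ z : Fin d → ℤ, {t : ℝ | t • p = intVec z}).Countable := by
    refine (hS.mono Set.sdiff_subset).biUnion fun p hp => Set.countable_iUnion fun z =>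
      Set.Subsingleton.countable fun t ht s hs => smul_left_injective ℝ hp.2 (ht.trans hs.symm)
  obtain ⟨t, ht⟩ := (hbad.dense_compl ℝ).nonempty
  refine ⟨t, fun p hp hp0 ⟨z, hz⟩ => ht ?_⟩
  simp only [Set.mem_iUnion]
  exact ⟨p, ⟨hp, hp0⟩, z, hz.symm⟩

-- Dilating the frequencies `p - p₀` by a suitable `t` makes all of them but `0` non-integral, so
-- that averaging over integer points isolates `a p₀`.
theorem eq_zero_of_tsum_mul_fourierChar_eq_zero {a : EuclideanSpace ℝ (Fin d) → ℂ}
    (ha : Summable a) (h : ∀ y, ∑' p, a p * 𝐞 (inner ℝ y p) = 0) : a = 0 := by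
  classical
  funext p₀
  obtain ⟨t, ht⟩ := exists_forall_smul_notMem_range_intVec
    (ha.countable_support.image fun p => p - p₀)
  have hshift (w : Fin d → ℤ) : ∑' p, a p * 𝐞 (inner ℝ (intVec w) (t • (p - p₀))) = 0 := by
    have hterm : ∀ p, a p * 𝐞 (inner ℝ (intVec w) (t • (p - p₀))) =
        a p * 𝐞 (inner ℝ (t • intVec w) p) * 𝐞 (-inner ℝ (t • intVec w) p₀) := fun p => by
      rw [mul_assoc, ← Circle.coe_mul, ← AddChar.map_add_eq_mul, inner_smul_right,
        inner_sub_right, inner_smul_left, inner_smul_left, conj_trivial]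
      ring_nf
    simp only [hterm, tsum_mul_right, h, zero_mul]
  have hlim := tendsto_boxAverage_tsum ha fun p => t • (p - p₀)
  simp only [hshift] at hlim
  have hzero := tendsto_nhds_unique hlim
    (tendsto_const_nhds.congr fun M => (by simp [boxAverage] : 0 = boxAverage _ M))
  rw [tsum_eq_single p₀ fun p hp => ?_, if_pos ⟨0, by simp⟩] at hzero
  · exact hzero
  · by_cases hap : a p = 0
    · rw [hap, ite_self]
    · exact if_neg (ht _ ⟨p, hap, rfl⟩ (sub_ne_zero.mpr hp))

end AlmostPeriodic

/-! ### Test functions -/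

theorem tendsto_eLpNorm_indicator_compl {α F : Type*} [MeasurableSpace α] {μ : Measure α}
    [NormedAddCommGroup F] {p : ℝ≥0∞} (hp : p ≠ ∞) {f : α → F} (hf : MemLp f p μ)
    {s : ℕ → Set α} (hs : ∀ n, MeasurableSet (s n)) (hmem : ∀ᵐ x ∂μ, ∀ᶠ n in atTop, x ∈ s n) :
    Tendsto (fun n => eLpNorm ((s n)ᶜ.indicator f) p μ) atTop (𝓝 0) := by
  rcases eq_or_ne p 0 with rfl | hp0
  · simp
  have hpos : 0 < p.toReal := ENNReal.toReal_pos hp0 hp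
  simp only [eLpNorm_eq_lintegral_rpow_enorm_toReal hp0 hp]
  suffices Tendsto (fun n => ∫⁻ x, ‖(s n)ᶜ.indicator f x‖ₑ ^ p.toReal ∂μ) atTop (𝓝 0) by
    simpa [hpos] using this.ennrpow_const (1 / p.toReal)
  rw [← lintegral_zero (μ := μ)]
  refine tendsto_lintegral_of_dominated_convergence' (fun x => ‖f x‖ₑ ^ p.toReal)
    (fun n => ((hf.1.indicator (hs n).compl).enorm.pow_const _)) (fun n => ae_of_all _ fun x => ?_)
    (lintegral_rpow_enorm_lt_top_of_eLpNorm_lt_top hp0 hp hf.2).ne ?_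
  · exact ENNReal.rpow_le_rpow (enorm_indicator_le_enorm_self _ _) hpos.le
  · filter_upwards [hmem] with x hx
    refine tendsto_const_nhds.congr' ?_
    filter_upwards [hx] with n hn
    rw [Set.indicator_of_notMem (Set.notMem_compl_iff.mpr hn), enorm_zero,
      ENNReal.zero_rpow_of_pos hpos]

section TestFunctions

variable {d : ℕ} {R S : ℝ} {F : EuclideanSpace ℝ (Fin d) → ℂ}

/-- Measurable functions which are bounded by `R` and supported in the annulus of parameter `R`.
As the Fourier transforms of test functions, they avoid the origin, where the windows of an affine
system accumulate. -/
structure IsTest (R : ℝ) (F : EuclideanSpace ℝ (Fin d) → ℂ) : Prop where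
  pos : 0 < R
  measurable : Measurable F
  norm_le : ∀ x, ‖F x‖ ≤ R
  eq_zero : ∀ x ∉ annulus R, F x = 0

/-- The functions in `L²(ℝᵈ)` whose Fourier transform is bounded and supported in an annulus. -/
def testSet (d : ℕ) : Set (L2 d) := {f | ∃ R F, IsTest R F ∧ (𝓕 f : L2 d) =ᵐ[volume] F}

namespace IsTest

theorem mono (hF : IsTest R F) (h : R ≤ S) : IsTest S F :=
  ⟨hF.pos.trans_le h, hF.measurable, fun x => (hF.norm_le x).trans h,
    fun x hx => hF.eq_zero x fun hx' => hx (annulus_subset_annulus hF.pos h hx')⟩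

theorem isBounded_support (hF : IsTest R F) : IsBounded (support F) :=
  Metric.isBounded_closedBall.subset fun x hx =>
    annulus_subset_closedBall R (not_imp_comm.mp (hF.eq_zero x) hx)

theorem memLp_mul (hF : IsTest R F) {u : EuclideanSpace ℝ (Fin d) → ℂ} (hu : MemLp u 2) :
    MemLp (fun x => F x * u x) 2 :=
  hu.of_le_mul (c := R) (hF.measurable.aestronglyMeasurable.mul hu.1) <| ae_of_all _ fun x => by
    rw [norm_mul]
    gcongr
    exact hF.norm_le x

theorem memLp (hF : IsTest R F) : MemLp F 2 := by
  have hone : MemLp ((annulus R).indicator fun _ : EuclideanSpace ℝ (Fin d) => (1 : ℂ)) 2 :=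
    memLp_indicator_const 2 (measurableSet_annulus R) 1
      (.inr (measure_closedBall_lt_top.trans_le' (measure_mono (annulus_subset_closedBall R))).ne)
  convert hF.memLp_mul hone using 2 with x
  by_cases hx : x ∈ annulus R
  · simp [hx]
  · simp [hF.eq_zero x hx]

theorem exists_fourier (hF : IsTest R F) : ∃ f : L2 d, (𝓕 f : L2 d) =ᵐ[volume] F := by
  refine ⟨𝓕⁻ (hF.memLp.toLp F), ?_⟩
  rw [FourierTransform.fourier_fourierInv_eq]
  exact hF.memLp.coeFn_toLp

theorem mul_fourierChar_neg (hF : IsTest R F) (y : EuclideanSpace ℝ (Fin d)) :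
    IsTest R fun x => F x * 𝐞 (-inner ℝ y x) := by
  simp only [← inner_neg_left]
  exact ⟨hF.pos, hF.measurable.mul (continuous_fourierChar_inner _).measurable,
    fun x => by simpa using hF.norm_le x, fun x hx => by simp [hF.eq_zero x hx]⟩

end IsTest

theorem isTest_indicator_annulus (hR : 0 < R) :
    IsTest R ((annulus R).indicator 1 : EuclideanSpace ℝ (Fin d) → ℂ) where
  pos := hR
  measurable := measurable_one.indicator (measurableSet_annulus R)
  norm_le x := by
    by_cases hx : x ∈ annulus R
    · have hone : R⁻¹ ≤ R := hx.1.trans hx.2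
      rw [inv_le_iff_one_le_mul₀ hR] at hone
      simpa [hx] using by nlinarith
    · simpa [hx] using hR.le
  eq_zero x hx := Set.indicator_of_notMem hx _

theorem eventually_mem_annulus {x : EuclideanSpace ℝ (Fin d)} (hx : x ≠ 0) :
    ∀ᶠ n : ℕ in atTop, x ∈ annulus ((n : ℝ) + 1) := by
  obtain ⟨n, hn⟩ := exists_nat_ge (max ‖x‖⁻¹ ‖x‖)
  filter_upwards [eventually_ge_atTop n] with m hm
  have hm : max ‖x‖⁻¹ ‖x‖ ≤ (m : ℝ) + 1 :=
    hn.trans (by exact_mod_cast hm.trans m.le_succ)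
  exact ⟨inv_le_of_inv_le₀ (norm_pos_iff.mpr hx) ((le_max_left _ _).trans hm),
    (le_max_right _ _).trans hm⟩

theorem dense_testSet [Nonempty (Fin d)] : Dense (testSet d) := fun f => by
  set h : L2 d := 𝓕 f
  let s : ℕ → Set (EuclideanSpace ℝ (Fin d)) := fun n => annulus (n + 1) ∩ {x | ‖h x‖ ≤ n + 1}
  have hmeas : Measurable h := (Lp.stronglyMeasurable h).measurable
  have hs : ∀ n, MeasurableSet (s n) := fun n =>
    (measurableSet_annulus _).inter (measurableSet_le hmeas.norm measurable_const)
  have htest : ∀ n : ℕ, IsTest (n + 1) ((s n).indicator h) := fun n =>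
    ⟨by positivity, hmeas.indicator (hs n), fun x => by
      by_cases hx : x ∈ s n
      · simpa [hx] using hx.2
      · simpa [hx] using by positivity, fun x hx => Set.indicator_of_notMem (fun h => hx h.1) _⟩
  have hmem : ∀ᵐ x, ∀ᶠ n in atTop, x ∈ s n := by
    filter_upwards [compl_mem_ae_iff.mpr (measure_singleton 0)] with x hx
    obtain ⟨m, hm⟩ := exists_nat_ge ‖h x‖
    filter_upwards [eventually_mem_annulus hx, eventually_ge_atTop m] with n hn hmn
    exact ⟨hn, hm.trans (by exact_mod_cast hmn.trans n.le_succ)⟩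
  have hlim : Tendsto (fun n => (htest n).memLp.toLp _) atTop (𝓝 h) := by
    refine (Lp.tendsto_Lp_iff_tendsto_eLpNorm' _ _).mpr ?_
    refine (tendsto_eLpNorm_indicator_compl (by simp) (Lp.memLp h) hs hmem).congr fun n => ?_
    refine eLpNorm_congr_norm_ae ?_
    filter_upwards [(htest n).memLp.coeFn_toLp] with x hx
    by_cases hxs : x ∈ s n <;> simp [hx, hxs]
  have hinv := (FourierTransform.continuous_fourierInv.tendsto h).comp hlim
  rw [FourierTransform.fourierInv_fourier_eq] at hinv
  refine mem_closure_of_tendsto hinv (Eventually.of_forall fun n => ⟨_, _, htest n, ?_⟩)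
  rw [comp_apply, FourierTransform.fourier_fourierInv_eq]
  exact (htest n).memLp.coeFn_toLp

end TestFunctions

/-! ### The mixed dual Gramian on the Fourier side -/

section GramTerm

variable {d : ℕ} {R : ℝ} {F G u v : EuclideanSpace ℝ (Fin d) → ℂ}

/-- The contribution of the frequency shift `p` and the windows `u`, `v` to the mixed dual Gramian,
tested against `F` and `G`. -/
noncomputable def gramTerm (u v F G : EuclideanSpace ℝ (Fin d) → ℂ)
    (p : EuclideanSpace ℝ (Fin d)) : ℂ :=
  ∫ x, F x * conj (G (x + p)) * (conj (u x) * v (x + p))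

theorem gramTerm_mul_fourierChar (y p : EuclideanSpace ℝ (Fin d)) :
    gramTerm u v (fun x => F x * 𝐞 (-inner ℝ y x)) (fun x => G x * 𝐞 (-inner ℝ y x)) p =
      gramTerm u v F G p * 𝐞 (inner ℝ y p) := by
  rw [gramTerm, gramTerm, ← integral_mul_const]
  refine integral_congr_ae (ae_of_all _ fun x => ?_)
  have hchar : (𝐞 (-inner ℝ y x) : ℂ) * conj (𝐞 (-inner ℝ y (x + p)) : ℂ) = 𝐞 (inner ℝ y p) := by
    rw [← Circle.coe_inv_eq_conj, ← AddChar.map_neg_eq_inv, ← Circle.coe_mul,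
      ← AddChar.map_add_eq_mul, inner_add_right, neg_neg, neg_add_cancel_left]
  simp only [map_mul, ← hchar]
  ring

theorem lintegral_enorm_gramTerm_le (hF : IsTest R F) (hG : IsTest R G)
    (hu : AEStronglyMeasurable u) (p : EuclideanSpace ℝ (Fin d)) :
    ∫⁻ x, ‖F x * conj (G (x + p)) * (conj (u x) * v (x + p))‖ₑ ≤
      ENNReal.ofReal R ^ 2 * (overlapEnergy R u p + overlapEnergy R v (-p)) := by
  set s : Set (EuclideanSpace ℝ (Fin d)) := annulus R ∩ (fun x => x + p) ⁻¹' annulus R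
  have hs : MeasurableSet s :=
    (measurableSet_annulus R).inter ((measurable_add_const p) (measurableSet_annulus R))
  have hshift : ∫⁻ x in s, ‖v (x + p)‖ₑ ^ 2 = overlapEnergy R v (-p) := by
    refine Eq.trans ?_ ((measurePreserving_add_right volume p).setLIntegral_comp_preimage_emb
      (measurableEmbedding_addRight p) (fun x => ‖v x‖ₑ ^ 2) _)
    congr 2 with x
    simp [s, and_comm]
  have hle : ∀ {H : EuclideanSpace ℝ (Fin d) → ℂ}, IsTest R H → ∀ x, ‖H x‖ₑ ≤ ENNReal.ofReal R :=
    fun hH x => by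
      rw [← ofReal_norm]
      exact ENNReal.ofReal_le_ofReal (hH.norm_le x)
  have hyoung : ∀ a b : ℝ≥0∞, a * b ≤ a ^ 2 + b ^ 2 := fun a b => by
    rcases le_total a b with h | h
    · exact (mul_le_mul_left h b).trans (by rw [← sq]; exact le_add_self)
    · exact (mul_le_mul_right h a).trans (by rw [← sq]; exact le_self_add)
  calc ∫⁻ x, ‖F x * conj (G (x + p)) * (conj (u x) * v (x + p))‖ₑ
      ≤ ∫⁻ x in s, ENNReal.ofReal R ^ 2 * (‖u x‖ₑ ^ 2 + ‖v (x + p)‖ₑ ^ 2) := by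
        rw [← lintegral_indicator hs]
        refine lintegral_mono fun x => ?_
        by_cases hx : x ∈ s
        · rw [Set.indicator_of_mem hx, enorm_mul, enorm_mul, enorm_mul, RCLike.enorm_conj,
            RCLike.enorm_conj, sq (ENNReal.ofReal R)]
          exact mul_le_mul' (mul_le_mul' (hle hF x) (hle hG _)) (hyoung _ _)
        · rcases not_and_or.mp hx with h | h
          · simp [hF.eq_zero x h]
          · simp [hG.eq_zero _ h]
    _ = ENNReal.ofReal R ^ 2 * (overlapEnergy R u p + overlapEnergy R v (-p)) := by
        rw [lintegral_const_mul' _ _ (by finiteness),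
          lintegral_add_left' (hu.enorm.pow_const 2).restrict, hshift]
        rfl

variable {M : Type*} {Λ : M → Set (EuclideanSpace ℝ (Fin d))}
  {U V : M → EuclideanSpace ℝ (Fin d) → ℂ}

theorem LocallyIntegrableSystem.tsum_lintegral_lt_top (hU : LocallyIntegrableSystem Λ U)
    (hV : LocallyIntegrableSystem Λ V) (hΛ : ∀ m, ∀ p ∈ Λ m, -p ∈ Λ m)
    (hUm : ∀ m, AEStronglyMeasurable (U m)) (hF : IsTest R F) (hG : IsTest R G) :
    ∑' q : M × EuclideanSpace ℝ (Fin d), (Λ q.1).indicator (fun p =>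
      ∫⁻ x, ‖F x * conj (G (x + p)) * (conj (U q.1 x) * V q.1 (x + p))‖ₑ) q.2 < ∞ := by
  have hterm : ∀ q : M × EuclideanSpace ℝ (Fin d), (Λ q.1).indicator (fun p =>
      ∫⁻ x, ‖F x * conj (G (x + p)) * (conj (U q.1 x) * V q.1 (x + p))‖ₑ) q.2 ≤
      ENNReal.ofReal R ^ 2 * ((Λ q.1).indicator (overlapEnergy R (U q.1)) q.2 +
        (Λ q.1).indicator (overlapEnergy R (V q.1)) (-q.2)) := fun ⟨m, p⟩ => by
    by_cases hp : p ∈ Λ m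
    · simpa [hp, hΛ m p hp] using lintegral_enorm_gramTerm_le hF hG (hUm m) p
    · simp [hp]
  refine (ENNReal.tsum_le_tsum hterm).trans_lt ?_
  rw [ENNReal.tsum_mul_left, ENNReal.tsum_add, ← ((Equiv.refl M).prodCongr
    (Equiv.neg (EuclideanSpace ℝ (Fin d)))).tsum_eq fun q : M × EuclideanSpace ℝ (Fin d) =>
      (Λ q.1).indicator (overlapEnergy R (V q.1)) (-q.2)]
  simp only [Equiv.prodCongr_apply, Equiv.neg_apply, Prod.map_apply', neg_neg, Equiv.refl_apply]
  exact ENNReal.mul_lt_top (by finiteness) (ENNReal.add_lt_top.mpr ⟨hU R hF.pos, hV R hF.pos⟩)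

theorem LocallyIntegrableSystem.tsum_enorm_gramTerm_lt_top (hU : LocallyIntegrableSystem Λ U)
    (hV : LocallyIntegrableSystem Λ V) (hΛ : ∀ m, ∀ p ∈ Λ m, -p ∈ Λ m)
    (hUm : ∀ m, AEStronglyMeasurable (U m)) (hF : IsTest R F) (hG : IsTest R G) :
    ∑' q : M × EuclideanSpace ℝ (Fin d),
      ‖(Λ q.1).indicator (gramTerm (U q.1) (V q.1) F G) q.2‖ₑ < ∞ := by
  refine (ENNReal.tsum_le_tsum fun q => ?_).trans_lt
    (hU.tsum_lintegral_lt_top hV hΛ hUm hF hG)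
  rw [enorm_indicator_eq_indicator_enorm]
  exact Set.indicator_le_indicator (enorm_integral_le_lintegral_enorm _)

theorem LocallyIntegrableSystem.summable_gramTerm (hU : LocallyIntegrableSystem Λ U)
    (hV : LocallyIntegrableSystem Λ V) (hΛ : ∀ m, ∀ p ∈ Λ m, -p ∈ Λ m)
    (hUm : ∀ m, AEStronglyMeasurable (U m)) (hF : IsTest R F) (hG : IsTest R G) :
    Summable fun q : M × EuclideanSpace ℝ (Fin d) =>
      (Λ q.1).indicator (gramTerm (U q.1) (V q.1) F G) q.2 :=
  .of_enorm (hU.tsum_enorm_gramTerm_lt_top hV hΛ hUm hF hG).ne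

end GramTerm

/-! ### Generalized shift-invariant systems -/

section ShiftInvariant

variable {d : ℕ} {M : Type*} {g : M → EuclideanSpace ℝ (Fin d) ≃L[ℝ] EuclideanSpace ℝ (Fin d)}
  {u v : M → EuclideanSpace ℝ (Fin d) → ℂ} {X Y : M × (Fin d → ℤ) → L2 d}

/-- The generalized shift-invariant system with generators of Fourier transform a multiple of `u m`
and with the translations by the dual lattice of `g m ℤᵈ`; the factor `√|det (g m)|⁻¹` normalizes
its mixed dual Gramians. -/
def IsShiftInvariantSystem (g : M → EuclideanSpace ℝ (Fin d) ≃L[ℝ] EuclideanSpace ℝ (Fin d))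
    (u : M → EuclideanSpace ℝ (Fin d) → ℂ) (X : M × (Fin d → ℤ) → L2 d) : Prop :=
  ∀ m z, (𝓕 (X (m, z)) : L2 d) =ᵐ[volume] fun x =>
    ((√(absDet (g m)) : ℝ) : ℂ)⁻¹ * (𝐞 (-inner ℝ (intVec z) ((g m).symm x)) * u m x)

theorem indicator_lattice_eq_add {α : Type*} [AddMonoid α]
    (g : EuclideanSpace ℝ (Fin d) ≃L[ℝ] EuclideanSpace ℝ (Fin d))
    (f : EuclideanSpace ℝ (Fin d) → α) (p : EuclideanSpace ℝ (Fin d)) :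
    (lattice g).indicator f p =
      ({0} : Set (EuclideanSpace ℝ (Fin d))).indicator f p + (lattice g \ {0}).indicator f p := by
  by_cases hp : p = 0
  · simp [hp, zero_mem_lattice]
  · by_cases hpg : p ∈ lattice g <;> simp [hp, hpg]

theorem enorm_gramTerm_indicator_zero {w : EuclideanSpace ℝ (Fin d) → ℂ} (hw : MemLp w 2) (R : ℝ) :
    ‖gramTerm w w ((annulus R).indicator 1) ((annulus R).indicator 1) 0‖ₑ =
      overlapEnergy R w 0 := by
  have hgram : gramTerm w w ((annulus R).indicator 1) ((annulus R).indicator 1) 0 =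
      ((∫ x in annulus R, ‖w x‖ ^ 2 : ℝ) : ℂ) := by
    rw [← integral_indicator (measurableSet_annulus R), ← integral_complex_ofReal, gramTerm]
    congr with x
    by_cases hx : x ∈ annulus R <;> simp [hx, Complex.conj_mul']
  rw [hgram, ← ofReal_norm, Complex.norm_of_nonneg (by positivity),
    ofReal_integral_eq_lintegral_ofReal hw.norm.integrable_sq.restrict
      (ae_of_all _ fun x => by positivity), overlapEnergy]
  simp [ENNReal.ofReal_pow]

namespace IsShiftInvariantSystem

theorem memLp (hX : IsShiftInvariantSystem g u X) (m : M) : MemLp (u m) 2 := by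
  have hpos : ((√(absDet (g m)) : ℝ) : ℂ) ≠ 0 :=
    Complex.ofReal_ne_zero.mpr (Real.sqrt_pos.mpr (absDet_pos _)).ne'
  refine ((Lp.memLp (𝓕 (X (m, 0)) : L2 d)).const_mul ((√(absDet (g m)) : ℝ) : ℂ)).ae_eq ?_
  filter_upwards [hX m 0] with x hx
  simp [hx, hpos]

theorem inner_eq (hX : IsShiftInvariantSystem g u X) {f : L2 d}
    {F : EuclideanSpace ℝ (Fin d) → ℂ} (hf : (𝓕 f : L2 d) =ᵐ[volume] F) (m : M) (z : Fin d → ℤ) :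
    inner ℂ (X (m, z)) f = ((√(absDet (g m)) : ℝ) : ℂ)⁻¹ *
      ∫ x, F x * conj (u m x) * 𝐞 (inner ℝ (intVec z) ((g m).symm x)) := by
  rw [← Lp.inner_fourier_eq, L2.inner_def, ← integral_const_mul]
  refine integral_congr_ae ?_
  filter_upwards [hf, hX m z] with x hfx hXx
  rw [hfx, hXx, RCLike.inner_apply, map_mul, map_mul, map_inv₀, Complex.conj_ofReal,
    ← Circle.coe_inv_eq_conj, ← AddChar.map_neg_eq_inv, neg_neg]
  ring

variable {R : ℝ} {F G : EuclideanSpace ℝ (Fin d) → ℂ} {f h : L2 d}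

theorem hasSum_layer (hX : IsShiftInvariantSystem g u X) (hY : IsShiftInvariantSystem g v Y)
    (hF : IsTest R F) (hG : IsTest R G) (hf : (𝓕 f : L2 d) =ᵐ[volume] F)
    (hh : (𝓕 h : L2 d) =ᵐ[volume] G) (m : M) :
    HasSum (fun z => inner ℂ (X (m, z)) f * inner ℂ h (Y (m, z)))
      (∑' p, (lattice (g m)).indicator (gramTerm (u m) (v m) F G) p) := by
  have hU : MemLp (fun x => F x * conj (u m x)) 2 := hF.memLp_mul (hX.memLp m).star
  have hV : MemLp (fun x => G x * conj (v m x)) 2 := hG.memLp_mul (hY.memLp m).star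
  have hsum := hasSum_integral_mul_fourierChar_lattice (g m) hU hV
    (hF.isBounded_support.subset (support_mul_subset_left _ _))
    (hG.isBounded_support.subset (support_mul_subset_left _ _))
  have hgram : ∀ p, ∫ x, F x * conj (u m x) * conj (G (x + p) * conj (v m (x + p))) =
      gramTerm (u m) (v m) F G p := fun p =>
    integral_congr_ae (ae_of_all _ fun x => by simp only [map_mul, Complex.conj_conj]; ring)
  rw [tsum_indicator_lattice, ← tsum_congr fun k => hgram (g m (intVec k))]
  refine hsum.congr_fun fun z => ?_
  have hsqrt : (absDet (g m) : ℂ)⁻¹ =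
      ((√(absDet (g m)) : ℝ) : ℂ)⁻¹ * ((√(absDet (g m)) : ℝ) : ℂ)⁻¹ := by
    rw [← mul_inv, ← Complex.ofReal_mul, Real.mul_self_sqrt (absDet_pos _).le]
  rw [← inner_conj_symm h, hX.inner_eq hf, hY.inner_eq hh, map_mul, map_inv₀, Complex.conj_ofReal,
    hsqrt]
  ring

theorem enorm_gramTerm_zero_le (hX : IsShiftInvariantSystem g u X)
    (hY : IsShiftInvariantSystem g v Y) (hF : IsTest R F) (hG : IsTest R G)
    (hf : (𝓕 f : L2 d) =ᵐ[volume] F) (hh : (𝓕 h : L2 d) =ᵐ[volume] G) {m : M}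
    (hsummable : Summable ((lattice (g m) \ {0}).indicator (gramTerm (u m) (v m) F G))) :
    ‖gramTerm (u m) (v m) F G 0‖ₑ ≤
      ∑' z, ‖inner ℂ (X (m, z)) f * inner ℂ h (Y (m, z))‖ₑ +
        ∑' p, ‖(lattice (g m) \ {0}).indicator (gramTerm (u m) (v m) F G) p‖ₑ := by
  have hlayer := (hX.hasSum_layer hY hF hG hf hh m).tsum_eq
  have hzero : HasSum (({0} : Set (EuclideanSpace ℝ (Fin d))).indicator
      (gramTerm (u m) (v m) F G)) (gramTerm (u m) (v m) F G 0) := by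
    rw [Set.indicator_singleton]
    exact hasSum_pi_single 0 _
  rw [tsum_congr (indicator_lattice_eq_add _ _), hzero.summable.tsum_add hsummable,
    hzero.tsum_eq] at hlayer
  rw [eq_sub_of_add_eq hlayer.symm]
  exact enorm_sub_le.trans (add_le_add enorm_tsum_le_tsum_enorm enorm_tsum_le_tsum_enorm)

theorem hasSum_gramTerm (hX : IsShiftInvariantSystem g u X) (hY : IsShiftInvariantSystem g v Y)
    (hF : IsTest R F) (hG : IsTest R G) (hf : (𝓕 f : L2 d) =ᵐ[volume] F)
    (hh : (𝓕 h : L2 d) =ᵐ[volume] G)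
    (hgram : Summable fun q : M × EuclideanSpace ℝ (Fin d) =>
      (lattice (g q.1)).indicator (gramTerm (u q.1) (v q.1) F G) q.2)
    (hinner : Summable fun j => inner ℂ (X j) f * inner ℂ h (Y j)) :
    HasSum (fun j => inner ℂ (X j) f * inner ℂ h (Y j))
      (∑' q : M × EuclideanSpace ℝ (Fin d),
        (lattice (g q.1)).indicator (gramTerm (u q.1) (v q.1) F G) q.2) := by
  have hlayer := hinner.hasSum.prod_fiberwise fun m => hX.hasSum_layer hY hF hG hf hh m
  rw [hgram.tsum_prod, hlayer.tsum_eq]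
  exact hinner.hasSum

theorem locallyIntegrableSystem (hX : IsShiftInvariantSystem g u X) (hbX : IsBessel X)
    (hu : LocallyIntegrableSystem (fun m => lattice (g m) \ {0}) u) :
    LocallyIntegrableSystem (fun m => lattice (g m)) u := by
  intro R hR
  have hF := isTest_indicator_annulus (d := d) hR
  obtain ⟨f, hf⟩ := hF.exists_fourier
  set F : EuclideanSpace ℝ (Fin d) → ℂ := (annulus R).indicator 1
  set c : M → EuclideanSpace ℝ (Fin d) → ℂ := fun m => gramTerm (u m) (u m) F F
  have hoff : ∑' q : M × EuclideanSpace ℝ (Fin d),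
      ‖(lattice (g q.1) \ {0}).indicator (c q.1) q.2‖ₑ < ∞ :=
    hu.tsum_enorm_gramTerm_lt_top hu
      (fun m p hp => ⟨neg_mem_lattice hp.1, by simpa using hp.2⟩) (fun m => (hX.memLp m).1) hF hF
  have hdiag : ∀ m, overlapEnergy R (u m) 0 ≤
      ∑' z, ‖inner ℂ (X (m, z)) f * inner ℂ f (X (m, z))‖ₑ +
        ∑' p, ‖(lattice (g m) \ {0}).indicator (c m) p‖ₑ := fun m => by
    rw [← enorm_gramTerm_indicator_zero (hX.memLp m)]
    exact hX.enorm_gramTerm_zero_le hX hF hF hf hf ((Summable.of_enorm hoff.ne).prod_factor m)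
  have hinner : ∑' j, ‖inner ℂ (X j) f * inner ℂ f (X j)‖ₑ < ∞ := by
    simpa only [ofReal_norm] using
      (hbX.summable_inner_mul_inner hbX f f).norm.tsum_ofReal_lt_top
  simp only [indicator_lattice_eq_add, ENNReal.tsum_add]
  refine ENNReal.add_lt_top.mpr ⟨?_, hu R hR⟩
  rw [ENNReal.tsum_prod (f := fun m p =>
    ({0} : Set (EuclideanSpace ℝ (Fin d))).indicator (overlapEnergy R (u m)) p)]
  simp only [← tsum_subtype, tsum_singleton]
  refine (ENNReal.tsum_le_tsum hdiag).trans_lt ?_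
  rw [ENNReal.tsum_add, ← ENNReal.tsum_prod, ← ENNReal.tsum_prod]
  exact ENNReal.add_lt_top.mpr ⟨hinner, hoff⟩

end IsShiftInvariantSystem

end ShiftInvariant

theorem ae_hasSum_zero_of_forall_setIntegral {α ι : Type*} [Countable ι] [MeasurableSpace α]
    {μ : Measure α} {w : ι → α → ℂ} (hw : ∀ i, AEStronglyMeasurable (w i) μ)
    (hfin : ∑' i, ∫⁻ x, ‖w i x‖ₑ ∂μ ≠ ∞)
    (h : ∀ s, MeasurableSet s → ∑' i, ∫ x in s, w i x ∂μ = 0) :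
    ∀ᵐ x ∂μ, HasSum (fun i => w i x) 0 := by
  have hsum : ∀ᵐ x ∂μ, Summable fun i => w i x := by
    filter_upwards [summable_norm_of_tsum_eLpNorm_ne_top le_rfl hw
      (by simpa only [eLpNorm_one_eq_lintegral_enorm] using hfin)] with x hx using hx.of_norm
  have hint : Integrable (fun x => ∑' i, w i x) μ := by
    refine ⟨aestronglyMeasurable_of_tendsto_ae atTop (f := fun (s : Finset ι) x => ∑ i ∈ s, w i x)
      (fun s => Finset.aestronglyMeasurable_fun_sum s fun i _ => hw i)
      (hsum.mono fun x hx => hx.hasSum), ?_⟩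
    refine (lintegral_mono fun x => enorm_tsum_le_tsum_enorm).trans_lt ?_
    rw [lintegral_tsum fun i => (hw i).enorm]
    exact hfin.lt_top
  have hzero := hint.ae_eq_zero_of_forall_setIntegral_eq_zero fun s hs _ => by
    rw [integral_tsum (fun i => (hw i).restrict), h s hs]
    exact ne_top_of_le_ne_top hfin (ENNReal.tsum_le_tsum fun i => setLIntegral_le_lintegral s _)
  filter_upwards [hsum, hzero] with x hx hx0
  exact (hx.hasSum_iff).mpr hx0

section Characterization

variable {d : ℕ} {M : Type*} {g : M → EuclideanSpace ℝ (Fin d) ≃L[ℝ] EuclideanSpace ℝ (Fin d)}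
  {u v : M → EuclideanSpace ℝ (Fin d) → ℂ} {X Y : M × (Fin d → ℤ) → L2 d}

/-- The contribution of the layer `m` to the coefficient function of the mixed dual Gramian at the
frequency shift `p`: it is present when `p` belongs to the lattice of the layer. -/
noncomputable def shiftTerm (g : M → EuclideanSpace ℝ (Fin d) ≃L[ℝ] EuclideanSpace ℝ (Fin d))
    (u v : M → EuclideanSpace ℝ (Fin d) → ℂ) (p : EuclideanSpace ℝ (Fin d)) (m : M)
    (x : EuclideanSpace ℝ (Fin d)) : ℂ :=
  (lattice (g m)).indicator (fun q => conj (u m x) * v m (x + q)) p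

variable {R : ℝ} {F G : EuclideanSpace ℝ (Fin d) → ℂ} {f h : L2 d}

theorem indicator_lattice_gramTerm (m : M) (p : EuclideanSpace ℝ (Fin d)) :
    (lattice (g m)).indicator (gramTerm (u m) (v m) F G) p =
      ∫ x, F x * conj (G (x + p)) * shiftTerm g u v p m x := by
  by_cases hp : p ∈ lattice (g m) <;> simp [shiftTerm, hp, gramTerm]

theorem IsTest.indicator (hF : IsTest R F) {s : Set (EuclideanSpace ℝ (Fin d))}
    (hs : MeasurableSet s) : IsTest R (s.indicator F) :=
  ⟨hF.pos, hF.measurable.indicator hs,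
    fun x => (norm_indicator_le_norm_self _ _).trans (hF.norm_le x),
    fun x hx => Set.indicator_apply_eq_zero.mpr fun _ => hF.eq_zero x hx⟩

theorem ae_of_forall_mem_annulus [Nonempty (Fin d)] {P : EuclideanSpace ℝ (Fin d) → Prop}
    (p : EuclideanSpace ℝ (Fin d))
    (hP : ∀ R > 0, ∀ᵐ x, x ∈ annulus R → x + p ∈ annulus R → P x) : ∀ᵐ x, P x := by
  have hall : ∀ᵐ x, ∀ n : ℕ, x ∈ annulus ((n : ℝ) + 1) → x + p ∈ annulus ((n : ℝ) + 1) → P x :=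
    ae_all_iff.mpr fun n => hP (n + 1) (by positivity)
  filter_upwards [hall, compl_mem_ae_iff.mpr (measure_singleton 0),
    compl_mem_ae_iff.mpr (measure_singleton (-p))] with x hx h0 hp
  obtain ⟨n, hn, hnp⟩ := ((eventually_mem_annulus h0).and
    (eventually_mem_annulus fun h => hp (eq_neg_of_add_eq_zero_left h))).exists
  exact hx n hn hnp

theorem LocallyIntegrableSystem.tsum_lintegral_shiftTerm_lt_top
    (hu : LocallyIntegrableSystem (fun m => lattice (g m)) u)
    (hv : LocallyIntegrableSystem (fun m => lattice (g m)) v)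
    (hum : ∀ m, AEStronglyMeasurable (u m)) (hF : IsTest R F) (hG : IsTest R G)
    (p : EuclideanSpace ℝ (Fin d)) :
    ∑' m, ∫⁻ x, ‖F x * conj (G (x + p)) * shiftTerm g u v p m x‖ₑ < ∞ := by
  refine lt_of_le_of_lt ?_
    (hu.tsum_lintegral_lt_top hv (fun m p => neg_mem_lattice) hum hF hG)
  refine le_trans (ENNReal.tsum_le_tsum fun m => ?_)
    (ENNReal.tsum_comp_le_tsum_of_injective (Prod.mk_left_injective p) _)
  by_cases hp : p ∈ lattice (g m) <;> simp [shiftTerm, hp]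

theorem aestronglyMeasurable_shiftTerm (hum : ∀ m, AEStronglyMeasurable (u m))
    (hvm : ∀ m, AEStronglyMeasurable (v m)) (hF : IsTest R F) (hG : IsTest R G)
    (p : EuclideanSpace ℝ (Fin d)) (m : M) :
    AEStronglyMeasurable fun x => F x * conj (G (x + p)) * shiftTerm g u v p m x := by
  have hGp : AEStronglyMeasurable fun x => conj (G (x + p)) :=
    (Complex.continuous_conj.measurable.comp
      (hG.measurable.comp (measurable_add_const p))).aestronglyMeasurable
  refine (hF.measurable.aestronglyMeasurable.mul hGp).mul ?_
  by_cases hp : p ∈ lattice (g m)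
  · exact (funext fun x => Set.indicator_of_mem hp _ : shiftTerm g u v p m = _) ▸
      (Complex.continuous_conj.comp_aestronglyMeasurable (hum m)).mul
        ((hvm m).comp_measurePreserving (measurePreserving_add_right volume p))
  · exact (funext fun x => Set.indicator_of_notMem hp _ : shiftTerm g u v p m = _) ▸
      aestronglyMeasurable_const

theorem LocallyIntegrableSystem.ae_hasSum_shiftTerm_iff [Countable M] [Nonempty (Fin d)]
    (hu : LocallyIntegrableSystem (fun m => lattice (g m)) u)
    (hv : LocallyIntegrableSystem (fun m => lattice (g m)) v)
    (hum : ∀ m, AEStronglyMeasurable (u m)) (hvm : ∀ m, AEStronglyMeasurable (v m))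
    (p : EuclideanSpace ℝ (Fin d)) :
    (∀ᵐ x, HasSum (fun m => shiftTerm g u v p m x) 0) ↔
      ∀ R F G, IsTest R F → IsTest R G →
        ∑' m, (lattice (g m)).indicator (gramTerm (u m) (v m) F G) p = 0 := by
  simp only [indicator_lattice_gramTerm]
  have hmeas {R F G} (hF : IsTest R F) (hG : IsTest R G) :=
    aestronglyMeasurable_shiftTerm (g := g) hum hvm hF hG p
  have hfin {R F G} (hF : IsTest R F) (hG : IsTest R G) :=
    (hu.tsum_lintegral_shiftTerm_lt_top hv hum hF hG p).ne
  refine ⟨fun h R F G hF hG => ?_, fun h => ae_of_forall_mem_annulus p fun R hR => ?_⟩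
  · rw [← integral_tsum (hmeas hF hG) (hfin hF hG)]
    refine integral_eq_zero_of_ae ?_
    filter_upwards [h] with x hx
    rw [tsum_mul_left, hx.tsum_eq, mul_zero, Pi.zero_apply]
  · have hF := isTest_indicator_annulus (d := d) hR
    filter_upwards [ae_hasSum_zero_of_forall_setIntegral (hmeas hF hF) (hfin hF hF) fun s hs => by
      rw [← h R _ _ (hF.indicator hs) hF]
      refine tsum_congr fun m => ?_
      rw [← integral_indicator hs]
      congr with x
      by_cases hx : x ∈ s <;> simp [hx]] with x hx hxR hxp
    simpa [hxR, hxp] using hx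

theorem LocallyIntegrableSystem.summable_tsum_gramTerm
    (hu : LocallyIntegrableSystem (fun m => lattice (g m)) u)
    (hv : LocallyIntegrableSystem (fun m => lattice (g m)) v)
    (hum : ∀ m, AEStronglyMeasurable (u m)) (hF : IsTest R F) (hG : IsTest R G) :
    Summable fun p => ∑' m, (lattice (g m)).indicator (gramTerm (u m) (v m) F G) p :=
  ((Equiv.prodComm _ _).summable_iff.mpr
    (hu.summable_gramTerm hv (fun _ _ => neg_mem_lattice) hum hF hG)).prod

namespace IsShiftInvariantSystem

theorem hasSum_modulated (hX : IsShiftInvariantSystem g u X) (hY : IsShiftInvariantSystem g v Y)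
    (hu : LocallyIntegrableSystem (fun m => lattice (g m)) u)
    (hv : LocallyIntegrableSystem (fun m => lattice (g m)) v) (hF : IsTest R F) (hG : IsTest R G)
    {y : EuclideanSpace ℝ (Fin d)}
    (hf : (𝓕 f : L2 d) =ᵐ[volume] fun x => F x * 𝐞 (-inner ℝ y x))
    (hh : (𝓕 h : L2 d) =ᵐ[volume] fun x => G x * 𝐞 (-inner ℝ y x))
    (hinner : Summable fun j => inner ℂ (X j) f * inner ℂ h (Y j)) :
    HasSum (fun j => inner ℂ (X j) f * inner ℂ h (Y j))
      (∑' p, (∑' m, (lattice (g m)).indicator (gramTerm (u m) (v m) F G) p) *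
        𝐞 (inner ℝ y p)) := by
  have hgram := hu.summable_gramTerm hv (fun _ _ => neg_mem_lattice) (fun m => (hX.memLp m).1)
    (hF.mul_fourierChar_neg y) (hG.mul_fourierChar_neg y)
  convert hX.hasSum_gramTerm hY (hF.mul_fourierChar_neg y) (hG.mul_fourierChar_neg y) hf hh hgram
    hinner using 1
  have hswap := (Equiv.prodComm (EuclideanSpace ℝ (Fin d)) M).hasSum_iff.mpr hgram.hasSum
  refine Eq.trans (tsum_congr fun p => ?_) (hswap.summable.tsum_prod.symm.trans hswap.tsum_eq)
  rw [← tsum_mul_right]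
  refine tsum_congr fun m => ?_
  by_cases hp : p ∈ lattice (g m) <;> simp [hp, gramTerm_mul_fourierChar]

theorem isOrthogonal_iff_tsum_gramTerm [Nonempty (Fin d)] (hX : IsShiftInvariantSystem g u X)
    (hY : IsShiftInvariantSystem g v Y) (hbX : IsBessel X) (hbY : IsBessel Y)
    (hu : LocallyIntegrableSystem (fun m => lattice (g m)) u)
    (hv : LocallyIntegrableSystem (fun m => lattice (g m)) v) :
    IsOrthogonal X Y ↔ ∀ R F G, IsTest R F → IsTest R G → ∀ p,
      ∑' m, (lattice (g m)).indicator (gramTerm (u m) (v m) F G) p = 0 := by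
  rw [hbX.isOrthogonal_iff_of_dense hbY dense_testSet]
  refine ⟨fun horth R F G hF hG => congrFun (eq_zero_of_tsum_mul_fourierChar_eq_zero
    (hu.summable_tsum_gramTerm hv (fun m => (hX.memLp m).1) hF hG) fun y => ?_), ?_⟩
  · obtain ⟨f, hf⟩ := (hF.mul_fourierChar_neg y).exists_fourier
    obtain ⟨h, hh⟩ := (hG.mul_fourierChar_neg y).exists_fourier
    exact (hX.hasSum_modulated hY hu hv hF hG hf hh
      (hbX.summable_inner_mul_inner hbY f h)).unique
      (horth f ⟨R, _, hF.mul_fourierChar_neg y, hf⟩ h ⟨R, _, hG.mul_fourierChar_neg y, hh⟩)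
  · rintro hzero f ⟨R, F, hF, hf⟩ h ⟨S, G, hG, hh⟩
    have hsum := hX.hasSum_modulated hY hu hv (hF.mono (le_max_left R S))
      (hG.mono (le_max_right R S)) (y := 0) (by simpa using hf) (by simpa using hh)
      (hbX.summable_inner_mul_inner hbY f h)
    simpa [hzero _ F G (hF.mono (le_max_left R S)) (hG.mono (le_max_right R S))] using hsum

theorem isOrthogonal_iff [Countable M] [Nonempty (Fin d)]
    (hX : IsShiftInvariantSystem g u X) (hY : IsShiftInvariantSystem g v Y) (hbX : IsBessel X)
    (hbY : IsBessel Y) (hu : LocallyIntegrableSystem (fun m => lattice (g m)) u)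
    (hv : LocallyIntegrableSystem (fun m => lattice (g m)) v) :
    IsOrthogonal X Y ↔ ∀ p, ∀ᵐ x, HasSum (fun m => shiftTerm g u v p m x) 0 := by
  rw [hX.isOrthogonal_iff_tsum_gramTerm hY hbX hbY hu hv]
  simp only [hu.ae_hasSum_shiftTerm_iff hv (fun m => (hX.memLp m).1) fun m => (hY.memLp m).1]
  exact ⟨fun h p R F G hF hG => h R F G hF hG p, fun h R F G hF hG p => h p R F G hF hG⟩

end IsShiftInvariantSystem

end Characterization

/-! ### Restriction to the integer frequencies -/

section Oversampling

variable {d : ℕ} {M : Type*} {g h : M → EuclideanSpace ℝ (Fin d) ≃L[ℝ] EuclideanSpace ℝ (Fin d)}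
  {u : M → EuclideanSpace ℝ (Fin d) → ℂ} {X Y : M × (Fin d → ℤ) → L2 d} {R : ℝ}
  {F : EuclideanSpace ℝ (Fin d) → ℂ} {f f' : L2 d}

theorem norm_eq_of_fourier_eq_mul_fourierChar {y : EuclideanSpace ℝ (Fin d)}
    (hf : (𝓕 f : L2 d) =ᵐ[volume] F)
    (hf' : (𝓕 f' : L2 d) =ᵐ[volume] fun x => F x * 𝐞 (-inner ℝ y x)) : ‖f'‖ = ‖f‖ := by
  rw [← Lp.norm_fourier_eq f', ← Lp.norm_fourier_eq f, Lp.norm_def, Lp.norm_def]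
  congr 1
  refine eLpNorm_congr_norm_ae ?_
  filter_upwards [hf, hf'] with x hx hx'
  simp [hx, hx']

theorem inner_mul_inner_swap (f g : L2 d) :
    inner ℂ f g * inner ℂ g f = ((‖inner ℂ f g‖ ^ 2 : ℝ) : ℂ) := by
  rw [← inner_conj_symm g f, Complex.mul_conj', Complex.ofReal_pow]

namespace IsShiftInvariantSystem

theorem summable_norm_inner_sq (hX : IsShiftInvariantSystem g u X)
    (hu : LocallyIntegrableSystem (fun m => lattice (g m)) u) (hF : IsTest R F)
    (hf : (𝓕 f : L2 d) =ᵐ[volume] F) : Summable fun j => ‖inner ℂ (X j) f‖ ^ 2 := by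
  have hlayer : ∀ m, HasSum (fun z => ((‖inner ℂ (X (m, z)) f‖ ^ 2 : ℝ) : ℂ))
      (∑' p, (lattice (g m)).indicator (gramTerm (u m) (u m) F F) p) := fun m => by
    simpa only [inner_mul_inner_swap] using hX.hasSum_layer hX hF hF hf hf m
  refine (summable_prod_of_nonneg fun j => by positivity).mpr
    ⟨fun m => Complex.summable_ofReal.mp (hlayer m).summable, Complex.summable_ofReal.mp ?_⟩
  simp only [Complex.ofReal_tsum, (hlayer _).tsum_eq]
  exact (hu.summable_gramTerm hu (fun _ _ => neg_mem_lattice) (fun m => (hX.memLp m).1) hF hF).prod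

theorem ofReal_tsum_norm_inner_sq (hX : IsShiftInvariantSystem g u X)
    (hu : LocallyIntegrableSystem (fun m => lattice (g m)) u) (hF : IsTest R F)
    {y : EuclideanSpace ℝ (Fin d)}
    (hf : (𝓕 f : L2 d) =ᵐ[volume] fun x => F x * 𝐞 (-inner ℝ y x)) :
    ((∑' j, ‖inner ℂ (X j) f‖ ^ 2 : ℝ) : ℂ) =
      ∑' p, (∑' m, (lattice (g m)).indicator (gramTerm (u m) (u m) F F) p) *
        𝐞 (inner ℝ y p) := by
  have hsum := hX.summable_norm_inner_sq hu (hF.mul_fourierChar_neg y) hf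
  rw [Complex.ofReal_tsum]
  simp only [← inner_mul_inner_swap]
  exact (hX.hasSum_modulated hX hu hu hF hF hf hf (by
    simpa only [inner_mul_inner_swap] using Complex.summable_ofReal.mpr hsum)).tsum_eq

open Classical in
-- Averaging over the modulations of a test function by `ℤᵈ` retains the integer frequencies only.
theorem isBessel_of_lattice_eq_inter [Nonempty (Fin d)] (hX : IsShiftInvariantSystem g u X)
    (hY : IsShiftInvariantSystem h u Y) (hbX : IsBessel X)
    (hu : LocallyIntegrableSystem (fun m => lattice (g m)) u)
    (hgh : ∀ m, lattice (h m) = lattice (g m) ∩ Set.range intVec) : IsBessel Y := by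
  obtain ⟨C, hC, hXC⟩ := hbX
  have hu' : LocallyIntegrableSystem (fun m => lattice (h m)) u :=
    hu.mono fun m => (hgh m).trans_subset Set.inter_subset_left
  refine isBessel_of_dense dense_testSet hC ?_
  rintro f ⟨R, F, hF, hf⟩ s
  refine ((hY.summable_norm_inner_sq hu' hF hf).sum_le_tsum s fun j _ => by positivity).trans ?_
  set c : EuclideanSpace ℝ (Fin d) → ℂ :=
    fun p => ∑' m, (lattice (g m)).indicator (gramTerm (u m) (u m) F F) p
  have hYsum : ((∑' j, ‖inner ℂ (Y j) f‖ ^ 2 : ℝ) : ℂ) =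
      ∑' p, if p ∈ Set.range intVec then c p else 0 := by
    rw [hY.ofReal_tsum_norm_inner_sq hu' hF (y := 0) (by simpa using hf)]
    refine tsum_congr fun p => ?_
    simp only [hgh, Set.inter_comm (lattice _), ← Set.indicator_indicator]
    by_cases hp : p ∈ Set.range intVec <;> simp [hp, c]
  have hbound : ∀ w, ‖∑' p, c p * 𝐞 (inner ℝ (intVec w) p)‖ ≤ C * ‖f‖ ^ 2 := fun w => by
    obtain ⟨f', hf'⟩ := (hF.mul_fourierChar_neg (intVec w)).exists_fourier
    rw [← hX.ofReal_tsum_norm_inner_sq hu hF hf', Complex.norm_of_nonneg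
      (tsum_nonneg fun j => by positivity), ← norm_eq_of_fourier_eq_mul_fourierChar hf hf']
    exact (hXC f').2
  have hlim := tendsto_boxAverage_tsum
    (hu.summable_tsum_gramTerm hu (fun m => (hX.memLp m).1) hF hF) id
  simp only [id] at hlim
  rw [← Complex.norm_of_nonneg (tsum_nonneg fun j => sq_nonneg ‖inner ℂ (Y j) f‖), hYsum]
  exact le_of_tendsto hlim.norm (Eventually.of_forall fun M => norm_boxAverage_le hbound M)

end IsShiftInvariantSystem

end Oversampling

/-! ### The Fourier transform of translations and dilations -/

section FourierOperators

variable {d : ℕ}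

/-- Multiplication by the character `w ↦ e^{-2πi⟨y, w⟩}` on `L²(ℝᵈ)`: the operator that the Fourier
transform turns translation by `y` into. -/
noncomputable def modulation (y : EuclideanSpace ℝ (Fin d)) : L2 d →L[ℂ] L2 d :=
  (ContinuousLinearMap.mul ℂ ℂ).holderL volume ∞ 2 2 <|
    (memLp_top_of_bound (continuous_fourierChar_inner (-y)).aestronglyMeasurable 1
      (ae_of_all _ fun _ => (Circle.norm_coe _).le)).toLp _

theorem coeFn_modulation (y : EuclideanSpace ℝ (Fin d)) (f : L2 d) :
    modulation y f =ᵐ[volume] fun w => 𝐞 (-inner ℝ y w) * f w := by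
  refine ((ContinuousLinearMap.mul ℂ ℂ).coeFn_holder (r := 2) _ f).trans ?_
  filter_upwards [MemLp.coeFn_toLp (memLp_top_of_bound
    (continuous_fourierChar_inner (-y)).aestronglyMeasurable 1
      (ae_of_all volume fun _ => (Circle.norm_coe _).le))] with w hw
  rw [ContinuousLinearMap.mul_apply', hw, inner_neg_left]

theorem eq_of_forall_schwartzMap_toLp {S T : L2 d → L2 d} (hS : Continuous S) (hT : Continuous T)
    (h : ∀ s : SchwartzMap (EuclideanSpace ℝ (Fin d)) ℂ, S (s.toLp 2) = T (s.toLp 2)) : S = T :=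
  (SchwartzMap.denseRange_toLpCLM (p := 2) ENNReal.ofNat_ne_top).equalizer hS hT (funext h)

theorem continuous_fourier_L2 : Continuous fun f : L2 d => (𝓕 f : L2 d) :=
  (Lp.fourierTransformₗᵢ (EuclideanSpace ℝ (Fin d)) ℂ).continuous

theorem coeFn_fourier_toLp (s : SchwartzMap (EuclideanSpace ℝ (Fin d)) ℂ) :
    (𝓕 (s.toLp 2 : L2 d) : L2 d) =ᵐ[volume] 𝓕 (s : EuclideanSpace ℝ (Fin d) → ℂ) := by
  rw [SchwartzMap.toLp_fourier_eq, ← SchwartzMap.fourier_coe]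
  exact SchwartzMap.coeFn_toLp _ 2 volume

theorem coeFn_translation (y : EuclideanSpace ℝ (Fin d)) (f : L2 d) :
    translation y f =ᵐ[volume] fun x => f (x - y) :=
  Lp.coeFn_compMeasurePreserving f (measurePreserving_sub_right volume y)

theorem translation_toLp (y : EuclideanSpace ℝ (Fin d))
    (s : SchwartzMap (EuclideanSpace ℝ (Fin d)) ℂ) :
    translation y (s.toLp 2) = (s.compSubConstCLM ℂ y).toLp 2 := by
  refine Lp.ext ((coeFn_translation y _).trans ?_)
  filter_upwards [(s.compSubConstCLM ℂ y).coeFn_toLp 2 volume,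
    (measurePreserving_sub_right volume y).quasiMeasurePreserving.ae (s.coeFn_toLp 2 volume)]
    with x hsub hs
  rw [hsub, hs, SchwartzMap.compSubConstCLM_apply]

theorem fourier_comp_sub (f : EuclideanSpace ℝ (Fin d) → ℂ) (y w : EuclideanSpace ℝ (Fin d)) :
    𝓕 (fun x => f (x - y)) w = 𝐞 (-inner ℝ y w) * 𝓕 f w := by
  have h := congrFun (VectorFourier.fourierIntegral_comp_add_right 𝐞 volume (innerₗ _) f (-y)) w
  rw [innerₗ_apply_apply, inner_neg_left] at h
  exact h

theorem fourier_translation (y : EuclideanSpace ℝ (Fin d)) (f : L2 d) :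
    (𝓕 (translation y f) : L2 d) = modulation y (𝓕 f) := by
  refine congrFun (eq_of_forall_schwartzMap_toLp (S := fun f => 𝓕 (translation y f))
    (T := fun f => modulation y (𝓕 f)) ?_ ?_ fun s => Lp.ext ?_) f
  · exact continuous_fourier_L2.comp
      (Lp.isometry_compMeasurePreserving (measurePreserving_sub_right volume y)).continuous
  · exact (modulation y).continuous.comp continuous_fourier_L2
  · simp only [translation_toLp]
    filter_upwards [coeFn_fourier_toLp (s.compSubConstCLM ℂ y), coeFn_fourier_toLp s,
      coeFn_modulation y (𝓕 (s.toLp 2))] with w hsub hs hmod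
    rw [hsub, hmod, hs, ← fourier_comp_sub]
    rfl

/-- An invertible matrix as an automorphism of Euclidean space. -/
noncomputable def matEquiv :
    GL (Fin d) ℝ →* (EuclideanSpace ℝ (Fin d) ≃L[ℝ] EuclideanSpace ℝ (Fin d)) :=
  (ContinuousLinearEquiv.unitsEquiv ℝ (EuclideanSpace ℝ (Fin d))).toMonoidHom.comp
    (Units.map (Matrix.toEuclideanCLM (n := Fin d) (𝕜 := ℝ) : _ →* _))

theorem matEquiv_apply (A : GL (Fin d) ℝ) (x : EuclideanSpace ℝ (Fin d)) :
    matEquiv A x = matVec (A : Matrix (Fin d) (Fin d) ℝ) x := rfl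

theorem absDet_matEquiv (A : GL (Fin d) ℝ) :
    absDet (matEquiv A) = |(A : Matrix (Fin d) (Fin d) ℝ).det| := by
  have hA : (matEquiv A : EuclideanSpace ℝ (Fin d) →ₗ[ℝ] EuclideanSpace ℝ (Fin d)) =
      Matrix.toEuclideanLin (A : Matrix (Fin d) (Fin d) ℝ) := rfl
  rw [absDet, hA, Matrix.toEuclideanLin, Matrix.toLpLin_eq_toLin, LinearMap.det_toLin]

theorem inner_matEquiv_star (A : GL (Fin d) ℝ) (x y : EuclideanSpace ℝ (Fin d)) :
    inner ℝ x (matEquiv (star A) y) = inner ℝ (matEquiv A x) y := by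
  have hA : matEquiv (star A) y = ContinuousLinearMap.adjoint
      (Matrix.toEuclideanCLM (n := Fin d) (𝕜 := ℝ) A) y := by
    rw [← ContinuousLinearMap.star_eq_adjoint, ← map_star]
    rfl
  rw [hA, ContinuousLinearMap.adjoint_inner_right]
  rfl

theorem fourier_comp_matEquiv (A : GL (Fin d) ℝ) (f : EuclideanSpace ℝ (Fin d) → ℂ)
    (w : EuclideanSpace ℝ (Fin d)) :
    𝓕 (f ∘ matEquiv A) w = (absDet (matEquiv A))⁻¹ • 𝓕 f (matEquiv (star A)⁻¹ w) := by
  rw [Real.fourier_eq, Real.fourier_eq, ← integral_comp_equiv]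
  refine integral_congr_ae (ae_of_all _ fun v => ?_)
  have hw : matEquiv (star A) (matEquiv (star A)⁻¹ w) = w := by
    rw [map_inv]
    exact (matEquiv (star A)).apply_symm_apply w
  simp only [comp_apply]
  rw [← inner_matEquiv_star, hw]

theorem substCLM_toLp (A : GL (Fin d) ℝ) (s : SchwartzMap (EuclideanSpace ℝ (Fin d)) ℂ) :
    substCLM A (s.toLp 2) =
      (SchwartzMap.compCLMOfContinuousLinearEquiv ℂ (matEquiv A) s).toLp 2 := by
  refine Lp.ext ((substCLM_coeFn A _).trans ?_)
  filter_upwards [(SchwartzMap.compCLMOfContinuousLinearEquiv ℂ (matEquiv A) s).coeFn_toLp 2 volume,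
    (quasiMeasurePreserving_matVec A).ae (s.coeFn_toLp 2 volume)] with x hcomp hs
  rw [hcomp, hs, SchwartzMap.compCLMOfContinuousLinearEquiv_apply, comp_apply, matEquiv_apply]

theorem fourier_substCLM (A : GL (Fin d) ℝ) (f : L2 d) :
    (𝓕 (substCLM A f) : L2 d) = (absDet (matEquiv A))⁻¹ • substCLM (star A)⁻¹ (𝓕 f) := by
  refine congrFun (eq_of_forall_schwartzMap_toLp (S := fun f => 𝓕 (substCLM A f))
    (T := fun f => (absDet (matEquiv A))⁻¹ • substCLM (star A)⁻¹ (𝓕 f)) ?_ ?_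
      fun s => Lp.ext ?_) f
  · exact continuous_fourier_L2.comp (substCLM A).continuous
  · exact ((substCLM (star A)⁻¹).continuous.comp continuous_fourier_L2).const_smul
      (absDet (matEquiv A))⁻¹
  · simp only [substCLM_toLp]
    filter_upwards [
      coeFn_fourier_toLp (SchwartzMap.compCLMOfContinuousLinearEquiv ℂ (matEquiv A) s),
      Lp.coeFn_smul (absDet (matEquiv A))⁻¹ (substCLM (star A)⁻¹ (𝓕 (s.toLp 2))),
      substCLM_coeFn (star A)⁻¹ (𝓕 (s.toLp 2)),
      (quasiMeasurePreserving_matVec (star A)⁻¹).ae (coeFn_fourier_toLp s)]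
      with w hcomp hsmul hsub hs
    rw [hcomp, hsmul, Pi.smul_apply, hsub, hs, ← matEquiv_apply, ← fourier_comp_matEquiv]
    rfl

theorem scalar_zpow (c : ℂˣ) (n : ℤ) : scalar (d := d) c ^ n = scalar (c ^ n) :=
  (map_zpow (ContinuousLinearEquiv.smulLeft : ℂˣ →* (L2 d ≃L[ℂ] L2 d)) c n).symm

theorem subst_zpow (A : GL (Fin d) ℝ) (n : ℤ) : subst A ^ n = subst (A ^ n) := by
  let substInv : GL (Fin d) ℝ →* (L2 d ≃L[ℂ] L2 d) :=
    MonoidHom.mk' (fun B => subst B⁻¹) fun B C => ContinuousLinearEquiv.ext <| funext fun f => by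
      rw [mul_inv_rev]
      exact (substCLM_comp B⁻¹ C⁻¹ f).symm
  have h : subst (A⁻¹ ^ n)⁻¹ = subst A⁻¹⁻¹ ^ n := map_zpow substInv A⁻¹ n
  rwa [inv_inv, inv_zpow, inv_inv, eq_comm] at h

theorem scalar_mul_subst_zpow_apply (c : ℂˣ) (A : GL (Fin d) ℝ) (n : ℤ) (f : L2 d) :
    ((scalar c * subst A) ^ n : L2 d ≃L[ℂ] L2 d) f = (c : ℂ) ^ n • substCLM (A ^ n) f := by
  have hcomm : Commute (scalar (d := d) c) (subst A) :=
    ContinuousLinearEquiv.ext (funext fun f => ((subst A).map_smul (c : ℂ) f).symm)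
  rw [hcomm.mul_zpow, scalar_zpow, subst_zpow, ← Units.val_zpow_eq_zpow_val]
  rfl

theorem absDet_zpow {E : Type*} [NormedAddCommGroup E] [NormedSpace ℝ E] (b : E ≃L[ℝ] E) (n : ℤ) :
    absDet (b ^ n) = absDet b ^ n := by
  let absDetHom : (E ≃L[ℝ] E) →* ℝ :=
    { toFun := absDet
      map_one' := (congrArg abs LinearMap.det_id).trans abs_one
      map_mul' := fun b c => (congrArg abs (LinearMap.det_comp _ _)).trans (abs_mul _ _) }
  exact map_zpow absDetHom b n

/-- The automorphism of the frequency side that corresponds to a dilation by `A`: the transpose `A*`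
of the paper, which over `ℝ` is `star A`. -/
noncomputable def dualEquiv (A : GL (Fin d) ℝ) :
    EuclideanSpace ℝ (Fin d) ≃L[ℝ] EuclideanSpace ℝ (Fin d) := matEquiv (star A)

theorem absDet_dualEquiv (A : GL (Fin d) ℝ) : absDet (dualEquiv A) = absDet (matEquiv A) := by
  rw [dualEquiv, absDet_matEquiv, absDet_matEquiv, Units.coe_star, Matrix.star_eq_conjTranspose,
    Matrix.conjTranspose_eq_transpose_of_trivial, Matrix.det_transpose]

theorem fourier_scalar_mul_subst_zpow (c : ℂˣ) (A : GL (Fin d) ℝ) (n : ℤ) (f : L2 d) :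
    (𝓕 (((scalar c * subst A) ^ n : L2 d ≃L[ℂ] L2 d) f) : L2 d) =ᵐ[volume] fun x =>
      ((c : ℂ) / absDet (dualEquiv A)) ^ n * (𝓕 f : L2 d) ((dualEquiv A ^ (-n)) x) := by
  rw [scalar_mul_subst_zpow_apply, FourierTransform.fourier_smul, fourier_substCLM, map_zpow,
    absDet_zpow, absDet_dualEquiv, star_zpow, ← zpow_neg (star A)]
  filter_upwards [Lp.coeFn_smul ((c : ℂ) ^ n)
      ((absDet (matEquiv A) ^ n)⁻¹ • substCLM (star A ^ (-n)) (𝓕 f)),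
    Lp.coeFn_smul (absDet (matEquiv A) ^ n)⁻¹ (substCLM (star A ^ (-n)) (𝓕 f)),
    substCLM_coeFn (star A ^ (-n)) (𝓕 f)] with x hc hdet hsub
  rw [hc, Pi.smul_apply, hdet, Pi.smul_apply, hsub, ← matEquiv_apply, map_zpow, smul_eq_mul,
    Complex.real_smul, div_zpow, div_eq_mul_inv, mul_assoc, Complex.ofReal_inv,
    Complex.ofReal_zpow]
  rfl

end FourierOperators

/-! ### Expansive matrices -/

theorem tendsto_pow_zero_of_spectralRadius_lt_one {𝔸 : Type*} [NormedRing 𝔸] [NormedAlgebra ℂ 𝔸]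
    [CompleteSpace 𝔸] {a : 𝔸} (ha : spectralRadius ℂ a < 1) :
    Tendsto (fun n : ℕ => a ^ n) atTop (𝓝 0) := by
  obtain ⟨t, hat, ht⟩ := ENNReal.lt_iff_exists_nnreal_btwn.mp ha
  refine squeeze_zero_norm' (a := fun n => ((t ^ n : NNReal) : ℝ)) ?_ ?_
  · filter_upwards [(spectrum.gelfand_formula a).eventually_lt_const hat, eventually_gt_atTop 0]
      with n hn hpos
    rw [one_div, ENNReal.rpow_inv_lt_iff (Nat.cast_pos.mpr hpos), ENNReal.rpow_natCast] at hn
    exact_mod_cast hn.le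
  · exact_mod_cast tendsto_pow_atTop_nhds_zero_of_lt_one t.coe_nonneg (by exact_mod_cast ht)

section Expansive

variable {d : ℕ} {A : GL (Fin d) ℝ}

theorem IsExpansive.norm_lt_one_of_mem_spectrum
    (hA : IsExpansive (A : Matrix (Fin d) (Fin d) ℝ)) {z : ℂ}
    (hz : z ∈ spectrum ℂ (((A⁻¹ : GL (Fin d) ℝ) : Matrix (Fin d) (Fin d) ℝ).map
      Complex.ofRealHom)) : ‖z‖ < 1 := by
  let U : GL (Fin d) ℂ := Matrix.GeneralLinearGroup.map Complex.ofRealHom A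
  have hzU : z ∈ spectrum ℂ ((U⁻¹ : GL (Fin d) ℂ) : Matrix (Fin d) (Fin d) ℂ) := hz
  have hz0 : z ≠ 0 := by
    rintro rfl
    exact (spectrum.zero_notMem_iff ℂ).mpr U⁻¹.isUnit hzU
  have hzinv : z⁻¹ ∈ spectrum ℂ (U : Matrix (Fin d) (Fin d) ℂ) := by
    simpa using (spectrum.inv_mem_iff (r := Units.mk0 z hz0) (a := U⁻¹)).mp hzU
  rw [← Matrix.spectrum_toLin', ← Module.End.hasEigenvalue_iff_mem_spectrum] at hzinv
  have h := hA _ hzinv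
  rwa [norm_inv, one_lt_inv₀ (norm_pos_iff.mpr hz0)] at h

open scoped Matrix.Norms.L2Operator in
theorem IsExpansive.tendsto_inv_pow [Nonempty (Fin d)]
    (hA : IsExpansive (A : Matrix (Fin d) (Fin d) ℝ)) :
    Tendsto (fun n : ℕ => ((A⁻¹ ^ n : GL (Fin d) ℝ) : Matrix (Fin d) (Fin d) ℝ)) atTop (𝓝 0) := by
  have hC := tendsto_pow_zero_of_spectralRadius_lt_one <|
    spectrum.spectralRadius_lt_of_forall_lt _ fun z hz => hA.norm_lt_one_of_mem_spectrum hz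
  have hre := ((Continuous.matrix_map continuous_id Complex.continuous_re).tendsto
    (0 : Matrix (Fin d) (Fin d) ℂ)).comp hC
  convert hre using 2 with n
  · rw [comp_apply, ← RingHom.mapMatrix_apply, ← map_pow, ← Units.val_pow_eq_pow_val]
    ext
    simp
  · ext
    simp

theorem IsExpansive.isExpanding_dualEquiv [Nonempty (Fin d)]
    (hA : IsExpansive (A : Matrix (Fin d) (Fin d) ℝ)) : IsExpanding (dualEquiv A) := by
  have hcont : Continuous fun M : Matrix (Fin d) (Fin d) ℝ =>
      ‖Matrix.toEuclideanCLM (n := Fin d) (𝕜 := ℝ) M.transpose‖ := by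
    exact (LinearMap.continuous_of_finiteDimensional
      ((Matrix.toEuclideanCLM (n := Fin d) (𝕜 := ℝ)).toAlgEquiv.toLinearMap ∘ₗ
        (Matrix.transposeLinearEquiv (Fin d) (Fin d) ℝ ℝ).toLinearMap)).norm
  have h := (hcont.tendsto 0).comp hA.tendsto_inv_pow
  rw [Matrix.transpose_zero, map_zero, norm_zero] at h
  refine h.congr fun n => congrArg norm ?_
  rw [dualEquiv, ← map_zpow, ← star_zpow, zpow_neg, zpow_natCast, ← inv_pow]
  rfl

end Expansive

/-! ### Affine and quasi-affine systems -/

section IntegerMatrix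

variable {d : ℕ} {b : EuclideanSpace ℝ (Fin d) ≃L[ℝ] EuclideanSpace ℝ (Fin d)}

theorem IsIntegerValued.lattice_dualEquiv_subset {A : GL (Fin d) ℝ}
    (hA : IsIntegerValued (A : Matrix (Fin d) (Fin d) ℝ)) :
    lattice (dualEquiv A) ⊆ Set.range intVec := by
  choose M hM using hA
  rintro _ ⟨k, rfl⟩
  refine ⟨fun i => ∑ j, M j i * k j, ?_⟩
  ext i
  change ((∑ j, M j i * k j : ℤ) : ℝ) = ∑ j, (star A : GL (Fin d) ℝ) i j * (k j : ℝ)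
  push_cast
  exact Finset.sum_congr rfl fun j _ => by rw [← hM]; rfl

theorem antitone_lattice_zpow (hb : lattice b ⊆ Set.range intVec) :
    Antitone fun n : ℤ => lattice (b ^ n) := by
  refine antitone_int_of_succ_le fun n => ?_
  rintro _ ⟨k, rfl⟩
  obtain ⟨l, hl⟩ := hb ⟨k, rfl⟩
  exact ⟨l, by simp only [hl, zpow_add_apply, zpow_one]⟩

theorem lattice_zpow_max_zero (hb : lattice b ⊆ Set.range intVec) (n : ℤ) :
    lattice (b ^ max n 0) = lattice (b ^ n) ∩ Set.range intVec :=
  (antitone_lattice_zpow hb).map_sup n 0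

end IntegerMatrix

section Layers

variable {d : ℕ} {ι : Type*} {b : EuclideanSpace ℝ (Fin d) ≃L[ℝ] EuclideanSpace ℝ (Fin d)}
  {ψ : ι → EuclideanSpace ℝ (Fin d) → ℂ}

/-- The functions `ψ i (b⁻ⁿ ·)`: on the Fourier side, the generators of the layers `(n, i)` of an
affine or quasi-affine system. -/
def dilates (b : EuclideanSpace ℝ (Fin d) ≃L[ℝ] EuclideanSpace ℝ (Fin d))
    (ψ : ι → EuclideanSpace ℝ (Fin d) → ℂ) (m : ℤ × ι) : EuclideanSpace ℝ (Fin d) → ℂ :=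
  ψ m.2 ∘ (b ^ (-m.1) :)

theorem IsExpanding.locallyIntegrableSystem_dilates [Finite ι] (hb : IsExpanding b)
    (hψ : ∀ i, MemLp (ψ i) 2) :
    LocallyIntegrableSystem (fun m : ℤ × ι => lattice (b ^ m.1) \ {0}) (dilates b ψ) := by
  have := Fintype.ofFinite ι
  intro R hR
  let e : (ℤ × ι) × EuclideanSpace ℝ (Fin d) ≃ ι × ℤ × EuclideanSpace ℝ (Fin d) :=
    ((Equiv.prodComm ℤ ι).prodCongr (Equiv.refl _)).trans (Equiv.prodAssoc _ _ _)
  rw [← e.symm.tsum_eq, ENNReal.tsum_prod', tsum_fintype]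
  exact ENNReal.sum_lt_top.mpr fun i _ => hb.locallyIntegrableSystem (hψ i) R hR

end Layers

section AffineSystems

variable {d r : ℕ}

/-- Groups the indices `(n, z, i)` into layers `(n, i)`, each with its translations `z`. -/
def layerEquiv (d r : ℕ) : (ℤ × Fin r) × (Fin d → ℤ) ≃ ℤ × (Fin d → ℤ) × Fin r :=
  (Equiv.prodAssoc _ _ _).trans ((Equiv.refl ℤ).prodCongr (Equiv.prodComm _ _))

theorem fourier_dilation_zpow_translation (A : GL (Fin d) ℝ) (n : ℤ)
    (y : EuclideanSpace ℝ (Fin d)) (f : L2 d) :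
    (𝓕 ((dilation A ^ n) (translation y f)) : L2 d) =ᵐ[volume] fun x =>
      ((√(absDet (dualEquiv A ^ n)) : ℝ) : ℂ)⁻¹ *
        (𝐞 (-inner ℝ y ((dualEquiv A ^ (-n)) x)) * (𝓕 f : L2 d) ((dualEquiv A ^ (-n)) x)) := by
  have hconst : √(absDet (dualEquiv A)) / absDet (dualEquiv A) = (√(absDet (dualEquiv A)))⁻¹ :=
    Real.sqrt_div_self
  have hsqrt : √(absDet (dualEquiv A) ^ n) = √(absDet (dualEquiv A)) ^ n := by
    have hpos := absDet_pos (dualEquiv A)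
    rw [Real.sqrt_eq_iff_mul_self_eq (by positivity) (by positivity), ← mul_zpow,
      Real.mul_self_sqrt hpos.le]
  have hmod := fourier_translation y f ▸ coeFn_modulation y (𝓕 f)
  filter_upwards [fourier_scalar_mul_subst_zpow (Units.mk0 _ _) A n (translation y f),
    (quasiMeasurePreserving_equiv (dualEquiv A ^ (-n))).ae hmod] with x hdil hx
  refine hdil.trans ?_
  rw [hx, Units.val_mk0, ← absDet_matEquiv, ← absDet_dualEquiv, ← Complex.ofReal_div, hconst,
    absDet_zpow, hsqrt, Complex.ofReal_zpow, Complex.ofReal_inv, inv_zpow]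

theorem fourier_translation_renormDilation_zpow (A : GL (Fin d) ℝ) (n : ℤ)
    (y : EuclideanSpace ℝ (Fin d)) (f : L2 d) :
    (𝓕 (translation y ((renormDilation A ^ n) f)) : L2 d) =ᵐ[volume] fun x =>
      𝐞 (-inner ℝ y x) * (𝓕 f : L2 d) ((dualEquiv A ^ (-n)) x) := by
  rw [fourier_translation]
  filter_upwards [coeFn_modulation y (𝓕 ((renormDilation A ^ n) f)),
    fourier_scalar_mul_subst_zpow (Units.mk0 _ _) A n f] with x hmod hdil
  refine hmod.trans (congrArg _ (hdil.trans ?_))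
  have hdet : (absDet (dualEquiv A) : ℂ) ≠ 0 := by exact_mod_cast (absDet_pos _).ne'
  rw [Units.val_mk0, ← absDet_matEquiv, ← absDet_dualEquiv, div_self hdet, one_zpow, one_mul]

theorem isShiftInvariantSystem_affineSystem (A : GL (Fin d) ℝ) (Ψ : Fin r → L2 d) :
    IsShiftInvariantSystem (fun m : ℤ × Fin r => dualEquiv A ^ m.1)
      (dilates (dualEquiv A) fun i => (𝓕 (Ψ i) : L2 d)) (affineSystem A Ψ ∘ layerEquiv d r) := by
  intro m z
  have h := fourier_dilation_zpow_translation A m.1 (intVec z) (Ψ m.2)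
  rw [zpow_neg] at h
  refine h.trans (.of_eq (funext fun x => ?_))
  simp only [dilates, comp_apply, zpow_neg]
  rfl

theorem isShiftInvariantSystem_quasiAffineSystem (A : GL (Fin d) ℝ) (Ψ : Fin r → L2 d) :
    IsShiftInvariantSystem (fun m : ℤ × Fin r => dualEquiv A ^ max m.1 0)
      (dilates (dualEquiv A) fun i => (𝓕 (Ψ i) : L2 d))
      (quasiAffineSystem A Ψ ∘ layerEquiv d r) := by
  rintro ⟨n, i⟩ z
  rcases le_or_gt 0 n with hn | hn
  · have hX : (quasiAffineSystem A Ψ ∘ layerEquiv d r) ((n, i), z) =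
        (affineSystem A Ψ ∘ layerEquiv d r) ((n, i), z) := if_pos hn
    simpa only [hX, max_eq_left hn] using isShiftInvariantSystem_affineSystem A Ψ (n, i) z
  · have hX : (quasiAffineSystem A Ψ ∘ layerEquiv d r) ((n, i), z) =
        translation (intVec z) ((renormDilation A ^ n) (Ψ i)) := if_neg hn.not_ge
    have hone : absDet (dualEquiv A ^ (0 : ℤ)) = 1 := by rw [absDet_zpow, zpow_zero]
    simp only [hX, max_eq_right hn.le, hone, Real.sqrt_one, Complex.ofReal_one, inv_one, one_mul]
    exact fourier_translation_renormDilation_zpow A n (intVec z) (Ψ i)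

end AffineSystems

/-! ### The orthogonality equations -/

section Equations

variable {d : ℕ} {ι : Type*} {b : EuclideanSpace ℝ (Fin d) ≃L[ℝ] EuclideanSpace ℝ (Fin d)}
  {ψ φ : ι → EuclideanSpace ℝ (Fin d) → ℂ} {a : ℂ} {x : EuclideanSpace ℝ (Fin d)}

theorem hasSum_shiftTerm_zero_iff
    {g : ℤ × ι → EuclideanSpace ℝ (Fin d) ≃L[ℝ] EuclideanSpace ℝ (Fin d)} :
    HasSum (fun m => shiftTerm g (dilates b ψ) (dilates b φ) 0 m x) a ↔
      HasSum (fun m : ℤ × ι => conj (ψ m.2 ((b ^ m.1) x)) * φ m.2 ((b ^ m.1) x)) a := by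
  rw [← ((Equiv.neg ℤ).prodCongr (Equiv.refl ι)).hasSum_iff]
  refine iff_of_eq (congrArg (HasSum · a) (funext fun m => ?_))
  simp [shiftTerm, dilates, zero_mem_lattice]

theorem zpow_intVec_mem_lattice_zpow_iff (hb : lattice b ⊆ Set.range intVec) {q : Fin d → ℤ}
    (hq : intVec q ∉ lattice b) {m n : ℤ} : (b ^ m) (intVec q) ∈ lattice (b ^ n) ↔ n ≤ m := by
  refine ⟨fun h => ?_, fun h => antitone_lattice_zpow hb h ⟨q, rfl⟩⟩
  by_contra! hmn
  obtain ⟨k, hk⟩ := antitone_lattice_zpow hb (Int.add_one_le_of_lt hmn) h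
  simp only [zpow_add_apply, zpow_one] at hk
  exact hq ⟨k, (b ^ m).injective hk⟩

theorem hasSum_shiftTerm_zpow_intVec_iff (hb : lattice b ⊆ Set.range intVec) {q : Fin d → ℤ}
    (hq : intVec q ∉ lattice b) (n : ℤ) :
    HasSum (fun m : ℤ × ι => shiftTerm (fun m => b ^ m.1) (dilates b ψ) (dilates b φ)
        ((b ^ n) (intVec q)) m x) a ↔
      HasSum (fun j : ℕ × ι => conj (ψ j.2 ((b ^ j.1) ((b ^ (-n)) x))) *
        φ j.2 ((b ^ j.1) ((b ^ (-n)) x + intVec q))) a := by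
  have hinj : Injective fun j : ℕ × ι => (n - (j.1 : ℤ), j.2) := by
    rintro ⟨j, i⟩ ⟨j', i'⟩ h
    simp_all
  rw [← hinj.hasSum_iff]
  · refine iff_of_eq (congrArg (HasSum · a) (funext fun j => ?_))
    have hmem : (b ^ n) (intVec q) ∈ lattice (b ^ (n - (j.1 : ℤ))) :=
      (zpow_intVec_mem_lattice_zpow_iff hb hq).mpr (by omega)
    have hpow : b ^ (-(n - (j.1 : ℤ))) = b ^ j.1 * b ^ (-n) := by
      rw [← zpow_natCast, ← zpow_add, neg_sub, sub_eq_add_neg]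
    simp only [comp_apply, shiftTerm, Set.indicator_of_mem hmem, dilates, hpow]
    change conj (ψ j.2 ((b ^ j.1) ((b ^ (-n)) x))) *
      φ j.2 ((b ^ j.1) ((b ^ (-n)) (x + (b ^ n) (intVec q)))) = _
    rw [map_add (b ^ (-n)), zpow_neg_apply_zpow]
  · rintro ⟨m, i⟩ hm
    refine Set.indicator_of_notMem (fun h => hm ⟨((n - m).toNat, i), ?_⟩) _
    have := (zpow_intVec_mem_lattice_zpow_iff hb hq).mp h
    simp only [Prod.mk.injEq, and_true]
    omega

theorem IsExpanding.exists_eq_zpow_intVec (hb : IsExpanding b) {p : EuclideanSpace ℝ (Fin d)}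
    (hp : p ≠ 0) (h : ∃ n : ℤ, p ∈ lattice (b ^ n)) :
    ∃ (n : ℤ) (q : Fin d → ℤ), intVec q ∉ lattice b ∧ (b ^ n) (intVec q) = p := by
  obtain ⟨N, hN⟩ := hb.exists_lt_norm_zpow_intVec (norm_pos_iff.mpr hp)
  have hbdd : ∀ n : ℤ, p ∈ lattice (b ^ n) → n ≤ N := by
    rintro n ⟨k, rfl⟩
    by_contra! hn
    exact (hN n hn.le k fun hk => hp (by simp [hk])).false
  obtain ⟨n, ⟨q, hq⟩, hmax⟩ := Int.exists_greatest_of_bdd ⟨N, hbdd⟩ h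
  refine ⟨n, q, ?_, hq⟩
  rintro ⟨k, hk⟩
  have := hmax (n + 1) ⟨k, by simp only [zpow_add_apply, zpow_one, hk, hq]⟩
  omega

theorem shiftTerm_of_lattice_eq_inter {M : Type*}
    {g h : M → EuclideanSpace ℝ (Fin d) ≃L[ℝ] EuclideanSpace ℝ (Fin d)}
    (hgh : ∀ m, lattice (h m) = lattice (g m) ∩ Set.range intVec)
    (u v : M → EuclideanSpace ℝ (Fin d) → ℂ) (p : EuclideanSpace ℝ (Fin d)) (m : M)
    (x : EuclideanSpace ℝ (Fin d)) :
    shiftTerm h u v p m x = (Set.range intVec).indicator (fun p => shiftTerm g u v p m x) p := by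
  simp only [shiftTerm, hgh, Set.inter_comm (lattice _), ← Set.indicator_indicator]

end Equations

section MatrixEquations

variable {d r : ℕ} {A : GL (Fin d) ℝ} {Ψ Φ : Fin r → L2 d}

theorem matVec_transpose_zpow (A : GL (Fin d) ℝ) (n : ℤ) (x : EuclideanSpace ℝ (Fin d)) :
    matVec ((A : Matrix (Fin d) (Fin d) ℝ).transpose ^ n) x = (dualEquiv A ^ n) x := by
  rw [dualEquiv, ← map_zpow, matEquiv_apply, Matrix.coe_units_zpow, Units.coe_star,
    Matrix.star_eq_conjTranspose, Matrix.conjTranspose_eq_transpose_of_trivial]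

theorem orthogonalityEquations_iff_dualEquiv :
    OrthogonalityEquations A Ψ Φ ↔
      (∀ q : Fin d → ℤ, intVec q ∉ lattice (dualEquiv A) →
        ∀ᵐ ξ, HasSum (fun j : ℕ × Fin r => conj ((𝓕 (Ψ j.2) : L2 d) ((dualEquiv A ^ j.1) ξ)) *
          (𝓕 (Φ j.2) : L2 d) ((dualEquiv A ^ j.1) (ξ + intVec q))) 0) ∧
      ∀ᵐ ξ, HasSum (fun m : ℤ × Fin r => conj ((𝓕 (Ψ m.2) : L2 d) ((dualEquiv A ^ m.1) ξ)) *
        (𝓕 (Φ m.2) : L2 d) ((dualEquiv A ^ m.1) ξ)) 0 := by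
  have hpow (n : ℕ) (x : EuclideanSpace ℝ (Fin d)) :
      matVec ((A : Matrix (Fin d) (Fin d) ℝ).transpose ^ n) x = (dualEquiv A ^ n) x := by
    rw [← zpow_natCast (dualEquiv A), ← matVec_transpose_zpow, zpow_natCast]
  have hone (x : EuclideanSpace ℝ (Fin d)) :
      matVec (A : Matrix (Fin d) (Fin d) ℝ).transpose x = dualEquiv A x := by
    rw [← zpow_one (A : Matrix (Fin d) (Fin d) ℝ).transpose, matVec_transpose_zpow, zpow_one]
  simp only [OrthogonalityEquations, matVec_transpose_zpow, hpow, hone, lattice, Set.mem_range,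
    eq_comm]

theorem OrthogonalityEquations.ae_hasSum_shiftTerm (h : OrthogonalityEquations A Ψ Φ)
    (hb : IsExpanding (dualEquiv A)) (hA : lattice (dualEquiv A) ⊆ Set.range intVec)
    (p : EuclideanSpace ℝ (Fin d)) :
    ∀ᵐ x, HasSum (fun m : ℤ × Fin r => shiftTerm (fun m => dualEquiv A ^ m.1)
      (dilates (dualEquiv A) fun i => (𝓕 (Ψ i) : L2 d))
      (dilates (dualEquiv A) fun i => (𝓕 (Φ i) : L2 d)) p m x) 0 := by
  obtain ⟨hoff, hdiag⟩ := orthogonalityEquations_iff_dualEquiv.mp h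
  rcases eq_or_ne p 0 with rfl | hp
  · filter_upwards [hdiag] with x hx using hasSum_shiftTerm_zero_iff.mpr hx
  by_cases hmem : ∃ n : ℤ, p ∈ lattice (dualEquiv A ^ n)
  · obtain ⟨n, q, hq, rfl⟩ := hb.exists_eq_zpow_intVec hp hmem
    filter_upwards [(quasiMeasurePreserving_equiv (dualEquiv A ^ (-n))).ae (hoff q hq)] with x hx
    exact (hasSum_shiftTerm_zpow_intVec_iff hA hq n).mpr hx
  · push Not at hmem
    simp [shiftTerm, hmem, hasSum_zero]

theorem orthogonalityEquations_of_ae_hasSum_shiftTerm_intVec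
    (hA : lattice (dualEquiv A) ⊆ Set.range intVec)
    (h : ∀ q : Fin d → ℤ, ∀ᵐ x, HasSum (fun m : ℤ × Fin r =>
      shiftTerm (fun m => dualEquiv A ^ m.1)
        (dilates (dualEquiv A) fun i => (𝓕 (Ψ i) : L2 d))
        (dilates (dualEquiv A) fun i => (𝓕 (Φ i) : L2 d)) (intVec q) m x) 0) :
    OrthogonalityEquations A Ψ Φ := by
  refine orthogonalityEquations_iff_dualEquiv.mpr ⟨fun q hq => ?_, ?_⟩
  · filter_upwards [h q] with x hx
    exact (hasSum_shiftTerm_zpow_intVec_iff (ψ := fun i => (𝓕 (Ψ i) : L2 d))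
      (φ := fun i => (𝓕 (Φ i) : L2 d)) hA hq 0).mp hx
  · have hzero := h 0
    rw [intVec_zero] at hzero
    filter_upwards [hzero] with x hx
    exact (hasSum_shiftTerm_zero_iff (ψ := fun i => (𝓕 (Ψ i) : L2 d))
      (φ := fun i => (𝓕 (Φ i) : L2 d))).mp hx

end MatrixEquations

section Orthogonality

variable {d r : ℕ} {A : GL (Fin d) ℝ} {Ψ Φ : Fin r → L2 d}

theorem IsBessel.locallyIntegrableSystem (hΨ : IsBessel (affineSystem A Ψ))
    (hb : IsExpanding (dualEquiv A)) :
    LocallyIntegrableSystem (fun m : ℤ × Fin r => lattice (dualEquiv A ^ m.1))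
      (dilates (dualEquiv A) fun i => (𝓕 (Ψ i) : L2 d)) :=
  (isShiftInvariantSystem_affineSystem A Ψ).locallyIntegrableSystem
    ((isBessel_comp_equiv_iff (layerEquiv d r)).mpr hΨ)
    (hb.locallyIntegrableSystem_dilates fun _ => Lp.memLp _)

variable [Nonempty (Fin d)]

theorem IsBessel.quasiAffineSystem (hΨ : IsBessel (affineSystem A Ψ))
    (hb : IsExpanding (dualEquiv A)) (hA : lattice (dualEquiv A) ⊆ Set.range intVec) :
    IsBessel (quasiAffineSystem A Ψ) := by
  rw [← isBessel_comp_equiv_iff (layerEquiv d r)] at hΨ ⊢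
  exact (isShiftInvariantSystem_affineSystem A Ψ).isBessel_of_lattice_eq_inter
    (isShiftInvariantSystem_quasiAffineSystem A Ψ) hΨ
    (((isBessel_comp_equiv_iff _).mp hΨ).locallyIntegrableSystem hb)
    fun m => lattice_zpow_max_zero hA m.1

theorem isOrthogonal_affineSystem_iff (hΨ : IsBessel (affineSystem A Ψ))
    (hΦ : IsBessel (affineSystem A Φ)) (hb : IsExpanding (dualEquiv A))
    (hA : lattice (dualEquiv A) ⊆ Set.range intVec) :
    IsOrthogonal (affineSystem A Ψ) (affineSystem A Φ) ↔ OrthogonalityEquations A Ψ Φ := by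
  rw [← isOrthogonal_comp_equiv_iff (layerEquiv d r),
    (isShiftInvariantSystem_affineSystem A Ψ).isOrthogonal_iff
      (isShiftInvariantSystem_affineSystem A Φ) ((isBessel_comp_equiv_iff _).mpr hΨ)
      ((isBessel_comp_equiv_iff _).mpr hΦ) (hΨ.locallyIntegrableSystem hb)
      (hΦ.locallyIntegrableSystem hb)]
  exact ⟨fun h => orthogonalityEquations_of_ae_hasSum_shiftTerm_intVec hA fun q => h (intVec q),
    fun h => h.ae_hasSum_shiftTerm hb hA⟩

theorem isOrthogonal_quasiAffineSystem_iff (hΨ : IsBessel (affineSystem A Ψ))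
    (hΦ : IsBessel (affineSystem A Φ)) (hb : IsExpanding (dualEquiv A))
    (hA : lattice (dualEquiv A) ⊆ Set.range intVec) :
    IsOrthogonal (quasiAffineSystem A Ψ) (quasiAffineSystem A Φ) ↔
      OrthogonalityEquations A Ψ Φ := by
  have hsub (m : ℤ × Fin r) :
      lattice (dualEquiv A ^ max m.1 0) ⊆ lattice (dualEquiv A ^ m.1) :=
    antitone_lattice_zpow hA (le_max_left m.1 0)
  rw [← isOrthogonal_comp_equiv_iff (layerEquiv d r),
    (isShiftInvariantSystem_quasiAffineSystem A Ψ).isOrthogonal_iff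
      (isShiftInvariantSystem_quasiAffineSystem A Φ)
      ((isBessel_comp_equiv_iff _).mpr (hΨ.quasiAffineSystem hb hA))
      ((isBessel_comp_equiv_iff _).mpr (hΦ.quasiAffineSystem hb hA))
      ((hΨ.locallyIntegrableSystem hb).mono hsub) ((hΦ.locallyIntegrableSystem hb).mono hsub)]
  simp only [shiftTerm_of_lattice_eq_inter fun m : ℤ × Fin r => lattice_zpow_max_zero hA m.1]
  refine ⟨fun h => orthogonalityEquations_of_ae_hasSum_shiftTerm_intVec hA fun q => ?_,
    fun h p => ?_⟩
  · simpa only [Set.indicator_of_mem (Set.mem_range_self q)] using h (intVec q)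
  · by_cases hp : p ∈ Set.range intVec
    · simpa only [Set.indicator_of_mem hp] using h.ae_hasSum_shiftTerm hb hA p
    · simp [Set.indicator_of_notMem hp, hasSum_zero]

end Orthogonality

/-! ### Dimension zero -/

section DimensionZero

variable {d r : ℕ} (A : GL (Fin d) ℝ)

theorem affineSystem_zero : affineSystem A (0 : Fin r → L2 d) = 0 := by
  ext1 p
  simp [affineSystem]

theorem quasiAffineSystem_zero : quasiAffineSystem A (0 : Fin r → L2 d) = 0 := by
  ext1 p
  simp [quasiAffineSystem]

theorem orthogonalityEquations_zero : OrthogonalityEquations A (0 : Fin r → L2 d) 0 := by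
  simp [OrthogonalityEquations, hasSum_zero]

variable {A} {Ψ : Fin r → L2 d}

theorem affineSystem_of_isEmpty [IsEmpty (Fin d)] (p : ℤ × (Fin d → ℤ) × Fin r) :
    affineSystem A Ψ p = Ψ p.2.2 := by
  have hdet : absDet (dualEquiv A) = 1 := by simp [absDet_dualEquiv, absDet_matEquiv]
  apply (FourierTransform.fourierEquiv ℂ (L2 d)).injective
  refine Lp.ext ((fourier_dilation_zpow_translation A p.1 (intVec p.2.1) (Ψ p.2.2)).trans
    (.of_eq (funext fun x => ?_)))
  rw [absDet_zpow, hdet, Subsingleton.elim (intVec p.2.1) 0,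
    Subsingleton.elim ((dualEquiv A ^ (-p.1)) x) x]
  simp

theorem IsBessel.eq_zero_of_isEmpty [IsEmpty (Fin d)] (h : IsBessel (affineSystem A Ψ)) :
    Ψ = 0 := by
  funext i
  obtain ⟨C, -, hC⟩ := h
  have hsum := (hC (Ψ i)).1.comp_injective (i := fun n : ℤ => (n, (0 : Fin d → ℤ), i))
    fun m n hmn => (Prod.mk.inj hmn).1
  simp only [comp_def, affineSystem_of_isEmpty] at hsum
  simpa using (summable_const_iff _).mp hsum

end DimensionZero

end OrthFrames

theorem corollaryC (d r : ℕ) (A : GL (Fin d) ℝ)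
    (hAint : OrthFrames.IsIntegerValued (A : Matrix (Fin d) (Fin d) ℝ))
    (hAexp : OrthFrames.IsExpansive (A : Matrix (Fin d) (Fin d) ℝ))
    (Ψ Φ : Fin r → OrthFrames.L2 d)
    (hΨ : OrthFrames.IsBessel (OrthFrames.affineSystem A Ψ))
    (hΦ : OrthFrames.IsBessel (OrthFrames.affineSystem A Φ)) :
    (OrthFrames.IsOrthogonal (OrthFrames.affineSystem A Ψ) (OrthFrames.affineSystem A Φ) ↔
      OrthFrames.OrthogonalityEquations A Ψ Φ) ∧
    OrthFrames.IsBessel (OrthFrames.quasiAffineSystem A Ψ) ∧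
    OrthFrames.IsBessel (OrthFrames.quasiAffineSystem A Φ) ∧
    (OrthFrames.IsOrthogonal (OrthFrames.quasiAffineSystem A Ψ)
        (OrthFrames.quasiAffineSystem A Φ) ↔
      OrthFrames.OrthogonalityEquations A Ψ Φ) := by
  open OrthFrames in
  rcases isEmpty_or_nonempty (Fin d) with hd | hd
  · obtain rfl := hΨ.eq_zero_of_isEmpty
    obtain rfl := hΦ.eq_zero_of_isEmpty
    rw [affineSystem_zero, quasiAffineSystem_zero]
    have h := orthogonalityEquations_zero (r := r) A
    exact ⟨iff_of_true isOrthogonal_zero h, isBessel_zero, isBessel_zero,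
      iff_of_true isOrthogonal_zero h⟩
  · have hb := hAexp.isExpanding_dualEquiv
    have hA := hAint.lattice_dualEquiv_subset
    exact ⟨isOrthogonal_affineSystem_iff hΨ hΦ hb hA, hΨ.quasiAffineSystem hb hA,
      hΦ.quasiAffineSystem hb hA, isOrthogonal_quasiAffineSystem_iff hΨ hΦ hb hA⟩
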